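/- **Theorem 1.6.** Let $n\ge 2$, $0<s<1$ and $M>0$. There is a constant $\alpha>0$, depending only on $n$, $s$ and $M$, with the following property. Let $x_0\in\mathbb R^n$, $0<r\le 1$, and let $B_\rho=B_\rho(x_0)$ denote the open ball of radius $\rho$ about $x_0$. Let $\vec b\in C^1(B_r;\mathbb R^n)$ satisfy $\|\vec b\|_{C^1(B_r)}=\sup_{B_r}|\vec b|+\sup_{B_r}|D\vec b|\le M$, let $c:B_r\to\mathbb R$ satisfy $c\le M$ a.e. in $B_r$, and let $u:\mathbb R^n\to\mathbb R$ be measurable with $$u\in\mathcal L_{2s},\quad\text{i.e.}\quad \int_{\mathbb R^n}\frac{|u(y)|}{1+|y|^{n+2s}}\,dy<\infty,\qquad u\ge 0\ \text{ a.e. in }\mathbb R^n,\qquad cu\in L^1_{\rm loc}(B_r).$$ Suppose that $$(-\Delta)^s u+\vec b\cdot\nabla u+cu\ \ge\ 0\quad\text{in }\mathcal D'(B_r),$$ that is, for every $\varphi\in C_c^\infty(B_r)$ with $\varphi\ge 0$, $$\int_{\mathbb R^n}u\,(-\Delta)^s\varphi\,dx-\int_{B_r}u\,\operatorname{div}(\varphi\,\vec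 b)\,dx+\int_{B_r}c\,u\,\varphi\,dx\ \ge\ 0,$$ where $(-\Delta)^s\varphi(x)=C_{n,s}\,\lim_{\varepsilon\to0^+}\int_{|x-y|>\varepsilon}\frac{\varphi(x)-\varphi(y)}{|x-y|^{n+2s}}\,dy$ and $C_{n,s}=\frac{s\,4^s\,\Gamma(n/2+s)}{\pi^{n/2}\,\Gamma(1-s)}$. If $m>0$ and $u\ge m$ a.e. in $B_r\setminus B_{r/2}$, then $$u\ge\alpha m\quad\text{a.e. in }B_r .$$ -/

import Mathlib

open MeasureTheory Filter Topology

noncomputable section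

namespace FracMaxPrinciple

/-- Euclidean space `ℝⁿ`. -/
abbrev E (n : ℕ) : Type := EuclideanSpace ℝ (Fin n)

/-- The weighted space `𝓛_a`: (measurable) functions `u` on `ℝⁿ` with
`∫ |u(y)| / (1 + |y|^{n+a}) dy < ∞`. -/
def MemL {n : ℕ} (a : ℝ) (u : E n → ℝ) : Prop :=
  Integrable (fun y : E n => u y / (1 + ‖y‖ ^ ((n : ℝ) + a))) volume

/-- The normalizing constant
`C_{n,s} = 4^s Γ(n/2 + s) / (π^{n/2} |Γ(-s)|) = s 4^s Γ(n/2 + s) / (π^{n/2} Γ(1 - s))`. -/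
def fracConst (n : ℕ) (s : ℝ) : ℝ :=
  s * (4 : ℝ) ^ s * Real.Gamma ((n : ℝ) / 2 + s) /
    (Real.pi ^ ((n : ℝ) / 2) * Real.Gamma (1 - s))

/-- The fractional Laplacian
`(-Δ)^s φ(x) = C_{n,s} P.V. ∫ (φ(x) - φ(y)) / |x - y|^{n+2s} dy`, where the principal value is the
limit as `ε → 0+` of the integrals over `|x - y| > ε`. It is only applied to smooth compactly
supported functions, for which the limit exists. -/
def fracLaplacian {n : ℕ} (s : ℝ) (φ : E n → ℝ) (x : E n) : ℝ :=
  fracConst n s * limUnder (𝓝[>] (0 : ℝ)) (fun ε : ℝ =>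
    ∫ y in (Metric.closedBall x ε)ᶜ, (φ x - φ y) / ‖x - y‖ ^ ((n : ℝ) + 2 * s))

/-- The divergence `∑ᵢ ∂ᵢ Fᵢ` of a vector field. -/
def divergence {n : ℕ} (F : E n → E n) (x : E n) : ℝ :=
  ∑ i : Fin n, fderiv ℝ (fun y => F y i) x (EuclideanSpace.single i 1)

/-- The `C¹(Ω)` norm `sup_Ω |b| + sup_Ω |Db|` of a vector field, with values in `[0, ∞]`. -/
def c1Norm {n : ℕ} (b : E n → E n) (Ω : Set (E n)) : ENNReal :=
  (⨆ x ∈ Ω, ‖b x‖ₑ) + ⨆ x ∈ Ω, ‖fderiv ℝ b x‖ₑ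

/-- The value at the test function `φ` of the distribution `(-Δ)^s u + b · ∇u + c u`, that is
`∫ u (-Δ)^s φ - ∫ u div(φ b) + ∫ c u φ`. -/
def pairing {n : ℕ} {Ω : TopologicalSpace.Opens (E n)} (s : ℝ) (b : E n → E n) (c u : E n → ℝ)
    (φ : TestFunction Ω ℝ ⊤) : ℝ :=
  (∫ x, u x * fracLaplacian s φ x)
    - (∫ x in (Ω : Set (E n)), u x * divergence (fun y => φ y • b y) x)
    + ∫ x in (Ω : Set (E n)), c x * u x * φ x

/-- `(-Δ)^s u + b · ∇u + c u ≥ 0` in `𝓓'(Ω)`. -/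
def IsSupersolution {n : ℕ} (s : ℝ) (b : E n → E n) (c u : E n → ℝ)
    (Ω : TopologicalSpace.Opens (E n)) : Prop :=
  ∀ φ : TestFunction Ω ℝ ⊤, (∀ x, 0 ≤ φ x) → 0 ≤ pairing s b c u φ

/-- The open ball `B_r(x₀)` as an open set. -/
def openBall {n : ℕ} (x₀ : E n) (r : ℝ) : TopologicalSpace.Opens (E n) :=
  ⟨Metric.ball x₀ r, Metric.isOpen_ball⟩

end FracMaxPrinciple

end

/-! Put `k = α m`, `S = B_{3r/4}` and `v = (u - k) 1_S`. The claim is that `v ≥ 0` almost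
everywhere. This gives `u ≥ k` in `S`, and in `B_r \ S` one already has `u ≥ m ≥ k`.

Truncation (`truncation_test_nonneg`). Write `u = v + k 1_S + u 1_{Sᶜ}` and test with `Φ ≥ 0`
supported in the closed ball of radius `5r/8`. The plateau `k 1_S` costs at most a multiple of `k
r^{-2s} ∫ Φ` in the nonlocal term (`setIntegral_fracLaplacian_le`). The exterior part contributes at
most a negative multiple of `m r^{-2s} ∫ Φ`, because `u ≥ 0` everywhere and `u ≥ m` on `B_r \ S`
(`setIntegral_mul_fracLaplacian_far_le`). The constant `k` is invisible to the drift, and since `u ≥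
0` the coefficient `c` may be replaced by an upper bound `N`, which costs `N k ∫ Φ`. If `α` is
small, the exterior gain pays for everything; `r ≤ 1` makes the choice independent of `r`. Hence
`(-Δ)^s v + b · ∇v + N v ≥ 0` on that ball in the tested sense.

Weak maximum principle (`ae_nonneg_of_forall_test`). Here `v` is integrable, `v ≥ -k`, and `v ≥ 0`
outside `B_{r/2}`. Since `v` has no regularity, its negative part cannot serve as a test function.
With an even mollifier `ρ`, let `w = ρ * v`, let `g` be the negative part of `w`, and test with `ρ *
g`. Evenness moves the second mollification onto `v`, so the nonlocal term becomes an energy of `w`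
against `g`, which is nonpositive because `g` is a decreasing function of `w`. The drift becomes `∫
(g² / 2) div b` plus a DiPerna–Lions commutator, and the zeroth order term is `-N ∫ g²`. A large `N`
absorbs the divergence and leaves `∫ g²` bounded by the commutator tested against `g`. As `g ≤ k`,
it is enough that the commutator tends to zero in `L¹`. That follows from the cancellation in
`integral_commKernel` and the continuity of translations in `L¹`. -/

noncomputable section

namespace FracMaxPrinciple

variable {n : ℕ} {s : ℝ}

/-! ### The fractional Laplacian of test functions -/

/-- The symmetric second difference `2φ(x) - φ(x+z) - φ(x-z)`. -/
def secondDiff (φ : E n → ℝ) (x z : E n) : ℝ := 2 * φ x - φ (x + z) - φ (x - z)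

theorem fracConst_pos (hs0 : 0 < s) (hs1 : s < 1) : 0 < fracConst n s := by
  unfold fracConst
  have h1 : 0 < Real.Gamma ((n : ℝ) / 2 + s) := Real.Gamma_pos_of_pos (by positivity)
  have h2 : 0 < Real.Gamma (1 - s) := Real.Gamma_pos_of_pos (by linarith)
  positivity

/-- In polar coordinates the integrand is `t^{1-2s}` near zero, integrable because `s < 1`, and
`t^{-1-2s}` at infinity, integrable because `s > 0`. This function dominates every second difference
quotient below. -/
theorem integrable_min_one_sq_div_rpow (hn : 2 ≤ n) (hs0 : 0 < s) (hs1 : s < 1) :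
    Integrable (fun z : E n => min 1 (‖z‖ ^ 2) / ‖z‖ ^ ((n : ℝ) + 2 * s)) := by
  have : Nonempty (Fin n) := ⟨⟨0, by omega⟩⟩
  have key := integrable_fun_norm_addHaar (volume : Measure (E n))
    (f := fun t : ℝ => min 1 (t ^ 2) / t ^ ((n : ℝ) + 2 * s))
  refine key.2 ?_
  have hfr : Module.finrank ℝ (E n) = n := by simp
  rw [hfr]
  have hexp : ∀ t : ℝ, 0 < t → t ^ (n - 1) • (min 1 (t ^ 2) / t ^ ((n : ℝ) + 2 * s))
      = min 1 (t ^ 2) * t ^ (-1 - 2 * s) := by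
    intro t ht
    rw [smul_eq_mul, ← Real.rpow_natCast t (n - 1), Nat.cast_sub (by omega), mul_div_left_comm,
      ← Real.rpow_sub ht]
    congr 2
    push_cast
    ring
  rw [← Set.Ioc_union_Ioi_eq_Ioi (zero_le_one (α := ℝ))]
  refine IntegrableOn.union ?_ ?_
  · have h1 : IntegrableOn (fun t : ℝ => t ^ (1 - 2 * s)) (Set.Ioc 0 1) := by
      rw [← intervalIntegrable_iff_integrableOn_Ioc_of_le zero_le_one]
      exact intervalIntegral.intervalIntegrable_rpow' (by linarith)
    refine h1.congr_fun (fun t ht => ?_) measurableSet_Ioc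
    have ht2 : t ^ 2 ≤ 1 := pow_le_one₀ ht.1.le ht.2
    change t ^ (1 - 2 * s) = t ^ (n - 1) • (min 1 (t ^ 2) / t ^ ((n : ℝ) + 2 * s))
    rw [hexp t ht.1, min_eq_right ht2, ← Real.rpow_natCast t 2, ← Real.rpow_add ht.1]
    congr 1
    push_cast
    ring
  · have h1 : IntegrableOn (fun t : ℝ => t ^ (-1 - 2 * s)) (Set.Ioi 1) :=
      integrableOn_Ioi_rpow_of_lt (by linarith) one_pos
    refine h1.congr_fun (fun t ht => ?_) measurableSet_Ioi
    have ht1 : 1 < t := ht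
    change _ = t ^ (n - 1) • (min 1 (t ^ 2) / t ^ ((n : ℝ) + 2 * s))
    rw [hexp t (by linarith), min_eq_left (one_le_pow₀ ht1.le), one_mul]

theorem measurable_norm_rpow (p : ℝ) : Measurable (fun z : E n => ‖z‖ ^ p) := by fun_prop

/-- The first-order Taylor expansions at `z` and `-z` have cancelling linear terms, and a Lipschitz
derivative makes the remainders quadratic. For large `z` the sup bound on `φ` takes over. The
constant is uniform in `x`, as Fubini requires. -/
theorem exists_abs_secondDiff_le {φ : E n → ℝ} (hφ : ContDiff ℝ 2 φ)
    (hc : HasCompactSupport φ) :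
    ∃ K : ℝ, 0 ≤ K ∧ ∀ x z, |secondDiff φ x z| ≤ K * min 1 (‖z‖ ^ 2) := by
  have hd : ContDiff ℝ 1 (fderiv ℝ φ) := hφ.fderiv_right (by norm_num)
  obtain ⟨L, hL⟩ := hd.lipschitzWith_of_hasCompactSupport (hc.fderiv ℝ) one_ne_zero
  obtain ⟨A, hA⟩ := hφ.continuous.bounded_above_of_compact_support hc
  have hA0 : 0 ≤ A := (norm_nonneg _).trans (hA 0)
  have hdiff : Differentiable ℝ φ := hφ.differentiable two_ne_zero
  have taylor : ∀ x z, |φ (x + z) - φ x - fderiv ℝ φ x z| ≤ L * ‖z‖ ^ 2 := by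
    intro x z
    have h2 := (convex_segment x (x + z)).norm_image_sub_le_of_norm_fderiv_le' (𝕜 := ℝ) (f := φ)
      (φ := fderiv ℝ φ x) (C := L * ‖z‖) (x := x) (y := x + z)
      (fun y _ => hdiff y) (fun y hy => ?_) (left_mem_segment ℝ _ _) (right_mem_segment ℝ _ _)
    · simpa [Real.norm_eq_abs, pow_two, mul_assoc] using h2
    · refine (hL.norm_sub_le y x).trans ?_
      gcongr
      rw [segment_eq_image'] at hy
      obtain ⟨t, ht, rfl⟩ := hy
      simp only [add_sub_cancel_left, norm_smul, Real.norm_eq_abs, abs_of_nonneg ht.1]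
      nlinarith [norm_nonneg z, ht.2]
  refine ⟨max (4 * A) (2 * L), le_max_of_le_left (by positivity), fun x z => ?_⟩
  have b1 : |secondDiff φ x z| ≤ 4 * A := by
    have h1 := abs_le.1 (hA x)
    have h2 := abs_le.1 (hA (x + z))
    have h3 := abs_le.1 (hA (x - z))
    rw [secondDiff, abs_le]
    constructor <;> linarith [h1.1, h1.2, h2.1, h2.2, h3.1, h3.2]
  have b2 : |secondDiff φ x z| ≤ 2 * L * ‖z‖ ^ 2 := by
    have h1 := abs_le.1 (taylor x z)
    have h2 := abs_le.1 (taylor x (-z))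
    rw [norm_neg, map_neg, ← sub_eq_add_neg] at h2
    rw [secondDiff, abs_le]
    constructor <;> linarith [h1.1, h1.2, h2.1, h2.2]
  rcases le_total 1 (‖z‖ ^ 2) with h | h
  · rw [min_eq_left h, mul_one]
    exact b1.trans (le_max_left _ _)
  · rw [min_eq_right h]
    exact b2.trans (by gcongr; exact le_max_right _ _)

theorem continuous_uncurry_secondDiff {φ : E n → ℝ} (hφ : Continuous φ) :
    Continuous (fun q : E n × E n => secondDiff φ q.1 q.2) := by
  unfold secondDiff
  fun_prop

theorem integrable_secondDiff_div (hn : 2 ≤ n) (hs0 : 0 < s) (hs1 : s < 1) {φ : E n → ℝ}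
    (hφ : ContDiff ℝ 2 φ) (hc : HasCompactSupport φ) (x : E n) :
    Integrable (fun z => secondDiff φ x z / ‖z‖ ^ ((n : ℝ) + 2 * s)) := by
  obtain ⟨K, -, hKb⟩ := exists_abs_secondDiff_le hφ hc
  refine ((integrable_min_one_sq_div_rpow hn hs0 hs1).const_mul K).mono' ?_ ?_
  · refine Measurable.aestronglyMeasurable ?_
    refine Measurable.div ?_ (measurable_norm_rpow _)
    have := hφ.continuous
    unfold secondDiff
    fun_prop
  · refine Eventually.of_forall fun z => ?_
    rw [Real.norm_eq_abs, abs_div, abs_of_nonneg (by positivity : 0 ≤ ‖z‖ ^ ((n : ℝ) + 2 * s)),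
      ← mul_div_assoc]
    gcongr
    exact hKb x z

theorem integrableOn_div_rpow_compl_closedBall (hn : 2 ≤ n) (hs0 : 0 < s) (hs1 : s < 1)
    {ε : ℝ} (hε : 0 < ε) :
    IntegrableOn (fun z : E n => 1 / ‖z‖ ^ ((n : ℝ) + 2 * s)) (Metric.closedBall 0 ε)ᶜ := by
  refine Integrable.mono' (((integrable_min_one_sq_div_rpow hn hs0 hs1).const_mul
    (1 / min 1 (ε ^ 2))).integrableOn) ?_ ?_
  · exact (measurable_const.div (measurable_norm_rpow _)).aestronglyMeasurable
  · refine (ae_restrict_iff' Metric.isClosed_closedBall.measurableSet.compl).2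
      (Eventually.of_forall fun z hz => ?_)
    have hz' : ε < ‖z‖ := by simpa using hz
    rw [Real.norm_eq_abs, abs_of_nonneg (by positivity), ← mul_div_assoc]
    gcongr
    rw [one_div, le_inv_mul_iff₀ (by positivity), mul_one]
    gcongr

/-- The principal value as an absolutely convergent integral of second differences. -/
theorem fracLaplacian_eq (hn : 2 ≤ n) (hs0 : 0 < s) (hs1 : s < 1) {φ : E n → ℝ}
    (hφ : ContDiff ℝ 2 φ) (hc : HasCompactSupport φ) (x : E n) :
    fracLaplacian s φ x =
      fracConst n s * (2⁻¹ * ∫ z, secondDiff φ x z / ‖z‖ ^ ((n : ℝ) + 2 * s)) := by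
  have hint := integrable_secondDiff_div hn hs0 hs1 hφ hc x
  unfold fracLaplacian
  congr 1
  refine Tendsto.limUnder_eq ?_
  obtain ⟨A, hA⟩ := hφ.continuous.bounded_above_of_compact_support hc
  have hcont := hφ.continuous
  set p := (n : ℝ) + 2 * s with hp
  have hms : ∀ ε : ℝ, MeasurableSet (Metric.closedBall (0 : E n) ε)ᶜ := fun ε =>
    Metric.isClosed_closedBall.measurableSet.compl
  have step : ∀ ε : ℝ, 0 < ε →
      ∫ y in (Metric.closedBall x ε)ᶜ, (φ x - φ y) / ‖x - y‖ ^ p =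
        2⁻¹ * ∫ z in (Metric.closedBall 0 ε)ᶜ, secondDiff φ x z / ‖z‖ ^ p := by
    intro ε hε
    have hi : ∀ σ : E n → E n, Continuous σ → IntegrableOn
        (fun z => (φ x - φ (σ z)) / ‖z‖ ^ p) (Metric.closedBall 0 ε)ᶜ := by
      intro σ hσ
      refine Integrable.mono' ((integrableOn_div_rpow_compl_closedBall hn hs0 hs1 hε).const_mul
        (2 * A)) ?_ (Eventually.of_forall fun z => ?_)
      · refine Measurable.aestronglyMeasurable ?_
        refine Measurable.div ?_ (measurable_norm_rpow _)
        fun_prop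
      · rw [norm_div, Real.norm_of_nonneg (by positivity : 0 ≤ ‖z‖ ^ p), ← hp, mul_one_div]
        gcongr
        refine (norm_sub_le _ _).trans ?_
        linarith [hA x, hA (σ z)]
    have e1 : ∫ y in (Metric.closedBall x ε)ᶜ, (φ x - φ y) / ‖x - y‖ ^ p =
        ∫ z in (Metric.closedBall 0 ε)ᶜ, (φ x - φ (x + z)) / ‖z‖ ^ p := by
      rw [← integral_indicator Metric.isClosed_closedBall.measurableSet.compl,
        ← integral_indicator (hms ε), ← integral_add_left_eq_self _ x]
      congr 1
      ext z
      by_cases hz : ‖z‖ ≤ ε <;> simp [Set.indicator, hz]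
    have e2 : ∫ y in (Metric.closedBall x ε)ᶜ, (φ x - φ y) / ‖x - y‖ ^ p =
        ∫ z in (Metric.closedBall 0 ε)ᶜ, (φ x - φ (x - z)) / ‖z‖ ^ p := by
      rw [← integral_indicator Metric.isClosed_closedBall.measurableSet.compl,
        ← integral_indicator (hms ε), ← integral_sub_left_eq_self _ volume x]
      congr 1
      ext z
      by_cases hz : ‖z‖ ≤ ε <;> simp [Set.indicator, hz]
    have e3 : ∫ z in (Metric.closedBall 0 ε)ᶜ, secondDiff φ x z / ‖z‖ ^ p =
        (∫ z in (Metric.closedBall 0 ε)ᶜ, (φ x - φ (x + z)) / ‖z‖ ^ p) +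
        ∫ z in (Metric.closedBall 0 ε)ᶜ, (φ x - φ (x - z)) / ‖z‖ ^ p := by
      rw [← integral_add (hi (fun z => x + z) (by fun_prop)) (hi (fun z => x - z) (by fun_prop))]
      congr 1
      ext z
      rw [secondDiff]
      ring
    rw [e3, ← e1, ← e2]
    ring
  have lim : Tendsto (fun ε : ℝ => ∫ z in (Metric.closedBall 0 ε)ᶜ,
      secondDiff φ x z / ‖z‖ ^ p) (𝓝[>] (0 : ℝ))
      (𝓝 (∫ z, secondDiff φ x z / ‖z‖ ^ p)) := by
    simp_rw [← fun ε => integral_indicator (f := fun z => secondDiff φ x z / ‖z‖ ^ p)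
      (μ := volume) (hms ε)]
    refine tendsto_integral_filter_of_dominated_convergence _ (Eventually.of_forall fun ε =>
      hint.aestronglyMeasurable.indicator (hms ε)) (Eventually.of_forall fun ε =>
      Eventually.of_forall fun z => norm_indicator_le_norm_self _ _) hint.norm
      (Eventually.of_forall fun z => ?_)
    rcases eq_or_ne z 0 with rfl | hz
    · have : secondDiff φ x (0 : E n) = 0 := by simp [secondDiff]; ring
      simp [Set.indicator, this]
    · refine tendsto_const_nhds.congr' ?_
      have : ∀ᶠ ε : ℝ in 𝓝[>] (0 : ℝ), ε < ‖z‖ :=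
        (eventually_lt_nhds (norm_pos_iff.2 hz)).filter_mono nhdsWithin_le_nhds
      filter_upwards [this] with ε hε
      rw [Set.indicator_of_mem]
      simpa using hε
  refine (lim.const_mul 2⁻¹).congr' ?_
  filter_upwards [self_mem_nhdsWithin] with ε hε
  exact (step ε hε).symm

/-- Fubini for the pairing of an integrable function with a fractional Laplacian. -/
theorem integral_mul_fracLaplacian (hn : 2 ≤ n) (hs0 : 0 < s) (hs1 : s < 1) {φ w : E n → ℝ}
    (hφ : ContDiff ℝ 2 φ) (hc : HasCompactSupport φ) (hw : Integrable w) :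
    Integrable (fun x => w x * fracLaplacian s φ x) ∧
    Integrable (fun z : E n => (∫ x, w x * secondDiff φ x z) / ‖z‖ ^ ((n : ℝ) + 2 * s)) ∧
    ∫ x, w x * fracLaplacian s φ x = fracConst n s * (2⁻¹ *
      ∫ z, (∫ x, w x * secondDiff φ x z) / ‖z‖ ^ ((n : ℝ) + 2 * s)) := by
  obtain ⟨K, -, hKb⟩ := exists_abs_secondDiff_le hφ hc
  set p := (n : ℝ) + 2 * s with hp
  have hprod : Integrable (fun q : E n × E n => w q.1 * (secondDiff φ q.1 q.2 / ‖q.2‖ ^ p))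
      (volume.prod volume) := by
    refine (hw.norm.mul_prod ((integrable_min_one_sq_div_rpow hn hs0 hs1).const_mul K)).mono'
      ?_ (Eventually.of_forall fun q => ?_)
    · refine hw.aestronglyMeasurable.comp_fst.mul ?_
      refine Measurable.aestronglyMeasurable ?_
      exact (continuous_uncurry_secondDiff hφ.continuous).measurable.div
        ((measurable_norm_rpow p).comp measurable_snd)
    · rw [norm_mul, norm_div, Real.norm_of_nonneg (by positivity : 0 ≤ ‖q.2‖ ^ p), ← hp]
      refine mul_le_mul_of_nonneg_left ?_ (norm_nonneg (w q.1))
      rw [← mul_div_assoc]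
      gcongr
      exact hKb _ _
  have h1 : ∀ x, w x * fracLaplacian s φ x = fracConst n s * (2⁻¹ *
      ∫ z, w x * (secondDiff φ x z / ‖z‖ ^ p)) := by
    intro x
    rw [fracLaplacian_eq hn hs0 hs1 hφ hc, integral_const_mul]
    ring
  have h2 : ∀ z : E n, (∫ x, w x * secondDiff φ x z) / ‖z‖ ^ p =
      ∫ x, w x * (secondDiff φ x z / ‖z‖ ^ p) := by
    intro z
    simp_rw [← mul_div_assoc]
    rw [integral_div]
  simp_rw [h1, h2]
  refine ⟨(hprod.integral_prod_left.const_mul _).const_mul _, hprod.integral_prod_right, ?_⟩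
  rw [integral_const_mul, integral_const_mul, integral_integral_swap hprod]

/-- Off the support of a test function the fractional Laplacian has no principal value. -/
theorem fracLaplacian_eq_of_forall_ball {φ : E n → ℝ} {x : E n} {δ : ℝ} (hδ : 0 < δ)
    (h : ∀ y, ‖x - y‖ < δ → φ y = 0) :
    fracLaplacian s φ x = -(fracConst n s * ∫ y, φ y / ‖x - y‖ ^ ((n : ℝ) + 2 * s)) := by
  unfold fracLaplacian
  rw [← mul_neg, ← integral_neg]
  congr 1
  refine Tendsto.limUnder_eq (tendsto_const_nhds.congr' ?_)
  have : ∀ᶠ ε : ℝ in 𝓝[>] (0 : ℝ), ε < δ :=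
    (eventually_lt_nhds hδ).filter_mono nhdsWithin_le_nhds
  filter_upwards [this] with ε hε
  have hx : φ x = 0 := h x (by simpa using hδ)
  rw [setIntegral_eq_integral_of_forall_compl_eq_zero]
  · simp [hx, neg_div]
  · intro y hy
    rw [hx, h y, sub_zero, zero_div]
    have : dist y x ≤ ε := by simpa using hy
    rw [← dist_eq_norm, dist_comm]
    linarith

/-! ### Mollifiers and continuity of translations in `L¹` -/

/-- An even mollifier at scale `ε`, with size controlled by `A`. -/
structure IsMollifier (A ε : ℝ) (ρ : E n → ℝ) : Prop where
  contDiff : ContDiff ℝ (⊤ : ℕ∞) ρ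
  even : ∀ z, ρ (-z) = ρ z
  nonneg : ∀ z, 0 ≤ ρ z
  integral_eq_one : ∫ z, ρ z = 1
  eq_zero_of_le : ∀ z, ε ≤ ‖z‖ → ρ z = 0
  le : ∀ z, ρ z ≤ A / ε ^ n
  norm_fderiv_le : ∀ z, ‖fderiv ℝ ρ z‖ ≤ A / ε ^ n / ε

/-- Rescale one fixed normalized bump. The point is that `A` does not depend on `ε`. -/
theorem exists_isMollifier (n : ℕ) :
    ∃ A : ℝ, 0 < A ∧ ∀ ε : ℝ, 0 < ε → ∃ ρ : E n → ℝ, IsMollifier A ε ρ := by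
  let f : ContDiffBump (0 : E n) := ⟨1 / 2, 1, by norm_num, by norm_num⟩
  set η : E n → ℝ := f.normed volume with hη
  have hsm : ContDiff ℝ (⊤ : ℕ∞) η := f.contDiff_normed
  have hcs : HasCompactSupport η := f.hasCompactSupport_normed
  obtain ⟨A₁, h₁⟩ := hsm.continuous.bounded_above_of_compact_support hcs
  obtain ⟨A₂, h₂⟩ := (hsm.continuous_fderiv (by simp)).bounded_above_of_compact_support
    (hcs.fderiv ℝ)
  refine ⟨max 1 (max A₁ A₂), by positivity, fun ε hε => ⟨fun z => (ε ^ n)⁻¹ * η (ε⁻¹ • z), ?_⟩⟩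
  refine ⟨?_, fun z => ?_, fun z => ?_, ?_, fun z hz => ?_, fun z => ?_, fun z => ?_⟩
  · exact contDiff_const.mul (hsm.comp (contDiff_const_smul _))
  · rw [smul_neg, hη, f.normed_neg]
  · exact mul_nonneg (by positivity) (f.nonneg_normed _)
  · rw [integral_const_mul, Measure.integral_comp_smul_of_nonneg _ _ _ (hR := by positivity), hη,
      f.integral_normed]
    simp [hε.ne']
  · have : η (ε⁻¹ • z) = 0 := by
      rw [← Function.notMem_support, hη, f.support_normed_eq]
      simp only [Metric.mem_ball, dist_zero_right, not_lt, norm_smul, norm_inv, Real.norm_eq_abs,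
        abs_of_pos hε]
      change 1 ≤ _
      rw [le_inv_mul_iff₀ hε]
      linarith
    simp [this]
  · rw [inv_mul_eq_div]
    gcongr
    exact (le_abs_self _).trans ((h₁ _).trans (by simp))
  · have hd : DifferentiableAt ℝ (fun z => η (ε⁻¹ • z)) z :=
      ((hsm.comp (contDiff_const_smul ε⁻¹)).differentiable (by simp)) z
    rw [fderiv_const_mul hd, fderiv_comp_smul, norm_smul, norm_smul, norm_inv, norm_inv,
      Real.norm_of_nonneg hε.le, Real.norm_of_nonneg (by positivity : 0 ≤ ε ^ n),
      div_div, div_eq_inv_mul, mul_inv, mul_assoc]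
    gcongr
    exact (h₂ _).trans (by simp)

theorem IsMollifier.hasCompactSupport {A ε : ℝ} {ρ : E n → ℝ} (h : IsMollifier A ε ρ) :
    HasCompactSupport ρ :=
  HasCompactSupport.intro (isCompact_closedBall 0 ε) fun z hz =>
    h.eq_zero_of_le z (by simpa using (not_le.1 (by simpa using hz)).le)

/-- Approximate `v` in `L¹` by a continuous compactly supported `g`. Uniform continuity controls the
translates of `g` on a slightly larger ball, and translation invariance bounds the two error terms.
-/
theorem exists_lintegral_translate_sub_le {v : E n → ℝ} (hv : Integrable v) {δ : ENNReal}
    (hδ : δ ≠ 0) :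
    ∃ ε₀ : ℝ, 0 < ε₀ ∧ ∀ z : E n, ‖z‖ < ε₀ → ∫⁻ x, ‖v (x + z) - v x‖ₑ ≤ δ := by
  have hδ3 : δ / 3 ≠ 0 := by simp [hδ]
  obtain ⟨g, hgc, hvg, hg, hgi⟩ := hv.exists_hasCompactSupport_lintegral_sub_le hδ3
  obtain ⟨R, hR⟩ := hgc.isBounded.subset_closedBall (0 : E n)
  have hvol : volume (Metric.closedBall (0 : E n) (R + 1)) ≠ ⊤ := measure_closedBall_lt_top.ne
  obtain ⟨a, ha0, ha⟩ : ∃ a : NNReal, 0 < a ∧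
      (a : ENNReal) * volume (Metric.closedBall (0 : E n) (R + 1)) < δ / 3 :=
    ENNReal.exists_nnreal_pos_mul_lt hvol hδ3
  have huc := hgc.uniformContinuous_of_continuous hg
  obtain ⟨ε, hε, hεg⟩ := Metric.uniformContinuous_iff.1 huc a ha0
  refine ⟨min ε 1, by positivity, fun z hz => ?_⟩
  have hz1 : ‖z‖ < ε := hz.trans_le (min_le_left _ _)
  have hz2 : ‖z‖ < 1 := hz.trans_le (min_le_right _ _)
  have hgz : ∫⁻ x, ‖g (x + z) - g x‖ₑ ≤ δ / 3 := by
    refine le_trans ?_ ha.le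
    rw [← lintegral_indicator_const Metric.isClosed_closedBall.measurableSet]
    refine lintegral_mono fun x => ?_
    by_cases hx : x ∈ Metric.closedBall (0 : E n) (R + 1)
    · rw [Set.indicator_of_mem hx]
      have := hεg (a := x + z) (b := x) (by simpa [dist_eq_norm] using hz1)
      rw [dist_eq_norm] at this
      rw [enorm_le_coe]
      exact this.le
    · rw [Set.indicator_of_notMem hx]
      have hx' : R + 1 < ‖x‖ := by simpa using hx
      have h1 : g x = 0 := by
        refine image_eq_zero_of_notMem_tsupport fun h => ?_
        have := hR h
        simp only [Metric.mem_closedBall, dist_zero_right] at this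
        linarith
      have h2 : g (x + z) = 0 := by
        refine image_eq_zero_of_notMem_tsupport fun h => ?_
        have := hR h
        simp only [Metric.mem_closedBall, dist_zero_right] at this
        have := norm_sub_norm_le x (-z)
        rw [norm_neg, sub_neg_eq_add] at this
        linarith
      simp [h1, h2]
  have hm : AEMeasurable (fun x => ‖v x - g x‖ₑ) :=
    (hv.aestronglyMeasurable.sub hgi.aestronglyMeasurable).enorm
  have hmz : AEMeasurable (fun x => ‖v (x + z) - g (x + z)‖ₑ) :=
    hm.comp_quasiMeasurePreserving (measurePreserving_add_right volume z).quasiMeasurePreserving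
  calc ∫⁻ x, ‖v (x + z) - v x‖ₑ
      ≤ ∫⁻ x, (‖v (x + z) - g (x + z)‖ₑ + (‖v x - g x‖ₑ + ‖g (x + z) - g x‖ₑ)) := by
        refine lintegral_mono fun x => ?_
        have : v (x + z) - v x = (v (x + z) - g (x + z)) + (-(v x - g x) + (g (x + z) - g x)) := by
          ring
        rw [this]
        refine (enorm_add_le _ _).trans ?_
        gcongr
        refine (enorm_add_le _ _).trans ?_
        rw [enorm_neg]
    _ = (∫⁻ x, ‖v (x + z) - g (x + z)‖ₑ) + ((∫⁻ x, ‖v x - g x‖ₑ) +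
          ∫⁻ x, ‖g (x + z) - g x‖ₑ) := by
        rw [lintegral_add_left' hmz, lintegral_add_left' hm]
    _ ≤ δ / 3 + (δ / 3 + δ / 3) := by
        rw [lintegral_add_right_eq_self (fun x => ‖v x - g x‖ₑ) z]
        gcongr
    _ = δ := by rw [← add_assoc, ENNReal.add_thirds]

/-- Averaged oscillation of an integrable function at small scales. -/
theorem exists_lintegral_oscillation_le {v : E n → ℝ} (hv : Integrable v) {δ : ENNReal}
    (hδ : δ ≠ 0) :
    ∃ ε₀ : ℝ, 0 < ε₀ ∧ ∀ ε : ℝ, 0 < ε → ε < ε₀ →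
      ∫⁻ x, ∫⁻ y in Metric.ball x ε, ‖v y - v x‖ₑ ≤ ENNReal.ofReal (ε ^ n) * δ := by
  set V := volume (Metric.ball (0 : E n) 1) with hV
  have hVt : V ≠ ⊤ := measure_ball_lt_top.ne
  obtain ⟨a, ha0, ha⟩ : ∃ a : NNReal, 0 < a ∧ (a : ENNReal) * V < δ :=
    ENNReal.exists_nnreal_pos_mul_lt hVt hδ
  obtain ⟨ε₀, hε₀, h⟩ := exists_lintegral_translate_sub_le hv (δ := a) (by simpa using ha0.ne')
  refine ⟨ε₀, hε₀, fun ε hε hεlt => ?_⟩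
  have hb : MeasurableSet (Metric.ball (0 : E n) ε) := measurableSet_ball
  have e1 : ∀ x : E n, ∫⁻ y in Metric.ball x ε, ‖v y - v x‖ₑ =
      ∫⁻ z in Metric.ball 0 ε, ‖v (x + z) - v x‖ₑ := by
    intro x
    rw [← lintegral_indicator measurableSet_ball, ← lintegral_indicator hb,
      ← lintegral_add_left_eq_self _ x]
    congr 1
    ext z
    by_cases hz : ‖z‖ < ε <;> simp [Set.indicator, hz]
  simp_rw [e1]
  have hvm : AEStronglyMeasurable (fun q : E n × E n => v (q.1 + q.2))
      (volume.prod volume) :=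
    (hv.aestronglyMeasurable.comp_snd (μ := volume)).comp_quasiMeasurePreserving
      (measurePreserving_prod_add volume volume).quasiMeasurePreserving
  have hm : AEMeasurable (fun q : E n × E n => ‖v (q.1 + q.2) - v q.1‖ₑ)
      (volume.prod (volume.restrict (Metric.ball 0 ε))) :=
    (hvm.sub hv.aestronglyMeasurable.comp_fst).enorm.mono_measure
      (Measure.prod_mono le_rfl Measure.restrict_le_self)
  rw [lintegral_lintegral_swap hm]
  calc ∫⁻ z in Metric.ball (0 : E n) ε, ∫⁻ x, ‖v (x + z) - v x‖ₑ
      ≤ ∫⁻ z in Metric.ball (0 : E n) ε, a := by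
        refine setLIntegral_mono measurable_const fun z hz => h z ?_
        have : ‖z‖ < ε := by simpa using hz
        linarith
    _ = a * volume (Metric.ball (0 : E n) ε) := by rw [setLIntegral_const]
    _ = ENNReal.ofReal (ε ^ n) * (a * V) := by
        rw [Measure.addHaar_ball_of_pos _ _ hε]
        simp only [finrank_euclideanSpace, Fintype.card_fin]
        ring
    _ ≤ _ := by gcongr

/-! ### Mollification as a self-adjoint operator, and the sign of the energy -/

/-- The convolution of `f` with the kernel `ρ`. -/
def mollify (ρ f : E n → ℝ) (x : E n) : ℝ := ∫ y, f y * ρ (x - y)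

section

variable {A ε : ℝ} {ρ : E n → ℝ}

theorem mollify_eq_convolution (ρ f : E n → ℝ) :
    mollify ρ f = convolution f ρ (ContinuousLinearMap.lsmul ℝ ℝ) volume := rfl

theorem IsMollifier.abs_le (h : IsMollifier A ε ρ) (z : E n) : |ρ z| ≤ A / ε ^ n := by
  rw [abs_of_nonneg (h.nonneg z)]
  exact h.le z

theorem IsMollifier.even_sub (h : IsMollifier A ε ρ) (x y : E n) : ρ (x - y) = ρ (y - x) := by
  rw [← h.even, neg_sub]

theorem IsMollifier.fderiv_sub_comm (h : IsMollifier A ε ρ) (x y : E n) :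
    fderiv ℝ ρ (x - y) = -fderiv ℝ ρ (y - x) := by
  have h1 : ρ = fun z => ρ (-z) := funext fun z => (h.even z).symm
  conv_lhs => rw [h1]
  have := fderiv_comp_smul (𝕜 := ℝ) (f := ρ) (c := (-1 : ℝ)) (x := x - y)
  simpa using this

theorem IsMollifier.integrable_mul (h : IsMollifier A ε ρ) {f : E n → ℝ} (hf : Integrable f)
    (x : E n) : Integrable (fun y => f y * ρ (x - y)) :=
  hf.mul_bdd (c := A / ε ^ n) (h.contDiff.continuous.comp
    (continuous_const.sub continuous_id)).aestronglyMeasurable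
    (Eventually.of_forall fun _ => h.abs_le _)

theorem IsMollifier.contDiff_mollify (h : IsMollifier A ε ρ) {f : E n → ℝ} (hf : Integrable f) :
    ContDiff ℝ (⊤ : ℕ∞) (mollify ρ f) :=
  h.hasCompactSupport.contDiff_convolution_right (ContinuousLinearMap.lsmul ℝ ℝ) hf.locallyIntegrable h.contDiff

theorem IsMollifier.contDiff_one (h : IsMollifier A ε ρ) : ContDiff ℝ 1 ρ :=
  h.contDiff.of_le (by exact_mod_cast le_top)

theorem IsMollifier.fderiv_mollify (h : IsMollifier A ε ρ) {f : E n → ℝ} (hf : Integrable f)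
    (x w : E n) : fderiv ℝ (mollify ρ f) x w = ∫ y, f y * fderiv ℝ ρ (x - y) w := by
  have h1 := h.contDiff_one
  have := h.hasCompactSupport.hasFDerivAt_convolution_right (ContinuousLinearMap.lsmul ℝ ℝ)
    hf.locallyIntegrable h1 x
  rw [mollify_eq_convolution, this.fderiv, convolution_precompR_apply _ hf.locallyIntegrable
    (h.hasCompactSupport.fderiv ℝ) (h1.continuous_fderiv one_ne_zero)]
  rfl

theorem IsMollifier.integrable (h : IsMollifier A ε ρ) : Integrable ρ :=
  h.contDiff.continuous.integrable_of_hasCompactSupport h.hasCompactSupport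

theorem IsMollifier.integrable_mollify (h : IsMollifier A ε ρ) {f : E n → ℝ} (hf : Integrable f) :
    Integrable (mollify ρ f) :=
  hf.integrable_convolution (ContinuousLinearMap.lsmul ℝ ℝ) h.integrable

theorem IsMollifier.mollify_nonneg (h : IsMollifier A ε ρ) {f : E n → ℝ} (hf : ∀ y, 0 ≤ f y)
    (x : E n) : 0 ≤ mollify ρ f x :=
  integral_nonneg fun y => mul_nonneg (hf y) (h.nonneg _)

theorem IsMollifier.integrable_prod (h : IsMollifier A ε ρ) {f g : E n → ℝ} (hf : Integrable f)
    (hg : Integrable g) :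
    Integrable (fun q : E n × E n => f q.1 * (g q.2 * ρ (q.1 - q.2))) (volume.prod volume) := by
  have := (hf.mul_prod hg).mul_bdd (c := A / ε ^ n) (f := fun q : E n × E n => f q.1 * g q.2)
    (g := fun q : E n × E n => ρ (q.1 - q.2))
    (h.contDiff.continuous.comp (continuous_fst.sub continuous_snd)).aestronglyMeasurable
    (Eventually.of_forall fun q => h.abs_le _)
  simpa only [mul_assoc] using this

theorem IsMollifier.integral_mul_mollify (h : IsMollifier A ε ρ) {f g : E n → ℝ}
    (hf : Integrable f) (hg : Integrable g) :
    ∫ x, f x * mollify ρ g x = ∫ x, mollify ρ f x * g x := by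
  have e1 : ∀ x, f x * mollify ρ g x = ∫ y, f x * (g y * ρ (x - y)) := fun x =>
    (integral_const_mul _ _).symm
  have e2 : ∀ y, mollify ρ f y * g y = ∫ x, f x * (g y * ρ (x - y)) := fun y => by
    rw [mollify, ← integral_mul_const]
    refine integral_congr_ae (Eventually.of_forall fun x => ?_)
    simp only [h.even_sub y x]
    ring
  simp_rw [e1, e2]
  exact integral_integral_swap (h.integrable_prod hf hg)

theorem mollify_add_right (ρ f : E n → ℝ) (x z : E n) :
    mollify ρ f (x + z) = mollify ρ (fun y => f (y + z)) x := by
  unfold mollify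
  rw [← integral_add_right_eq_self _ z]
  simp

theorem IsMollifier.mollify_eq_zero (h : IsMollifier A ε ρ) {f : E n → ℝ} {y : E n}
    (hf : ∀ x, ‖y - x‖ < ε → f x = 0) : mollify ρ f y = 0 := by
  unfold mollify
  refine integral_eq_zero_of_ae (Eventually.of_forall fun x => ?_)
  by_cases hx : ‖y - x‖ < ε
  · simp [hf x hx]
  · simp [h.eq_zero_of_le _ (not_lt.1 hx)]

theorem IsMollifier.le_mollify (h : IsMollifier A ε ρ) {f : E n → ℝ} (hf : Integrable f) {y : E n}
    {a : ℝ} (ha : ∀ᵐ x, ‖y - x‖ < ε → a ≤ f x) : a ≤ mollify ρ f y := by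
  have e : a = ∫ x, a * ρ (y - x) := by
    rw [integral_const_mul, integral_sub_left_eq_self ρ volume y, h.integral_eq_one, mul_one]
  rw [e]
  refine integral_mono_ae ((h.integrable.comp_sub_left y).const_mul a) (h.integrable_mul hf y) ?_
  filter_upwards [ha] with x hx
  by_cases hxy : ‖y - x‖ < ε
  · exact mul_le_mul_of_nonneg_right (hx hxy) (h.nonneg _)
  · simp [h.eq_zero_of_le _ (not_lt.1 hxy)]

/-- Evenness of `ρ` moves the mollification from `g` to `v`; translating the variable is then a
discrete integration by parts. The right side is a product of first differences, to which a sign can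
be given. -/
theorem integral_mul_secondDiff_mollify (h : IsMollifier A ε ρ) {v g : E n → ℝ}
    (hv : Integrable v) (hg : Continuous g) (hgc : HasCompactSupport g) (z : E n) :
    ∫ x, v x * secondDiff (mollify ρ g) x z =
      ∫ x, (mollify ρ v x - mollify ρ v (x + z)) * (g x - g (x + z)) := by
  set w := mollify ρ v with hw
  have hwi : Integrable w := h.integrable_mollify hv
  obtain ⟨G, hG⟩ := hg.bounded_above_of_compact_support hgc
  have hgi : Integrable g := hg.integrable_of_hasCompactSupport hgc
  have hb : ∀ a c : E n, Integrable (fun x => w (x + a) * g (x + c)) := fun a c =>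
    (hwi.comp_add_right a).mul_bdd (c := G) (by fun_prop) (Eventually.of_forall fun x => hG _)
  have hvm : ∀ a : E n, Integrable (fun x => v x * mollify ρ g (x + a)) := by
    intro a
    simp_rw [mollify_add_right]
    have hga : Integrable fun y => g (y + a) := hgi.comp_add_right a
    exact (h.integrable_prod hv hga).integral_prod_left.congr (Eventually.of_forall fun x => by
      simp only [mollify]
      rw [integral_const_mul])
  have hd : ∀ a : E n, ∫ x, v x * mollify ρ g (x + a) = ∫ x, w x * g (x + a) := by
    intro a
    simp_rw [mollify_add_right]
    exact h.integral_mul_mollify hv (hgi.comp_add_right a)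
  have e1 : ∀ x, v x * secondDiff (mollify ρ g) x z = 2 * (v x * mollify ρ g (x + 0)) -
      v x * mollify ρ g (x + z) - v x * mollify ρ g (x + -z) := by
    intro x
    rw [secondDiff, add_zero, ← sub_eq_add_neg]
    ring
  have e2 : ∀ x, (w x - w (x + z)) * (g x - g (x + z)) = w (x + 0) * g (x + 0)
      - w (x + 0) * g (x + z) - w (x + z) * g (x + 0) + w (x + z) * g (x + z) := by
    intro x
    rw [add_zero]
    ring
  simp_rw [e1, e2]
  have i1 : Integrable fun x => 2 * (v x * mollify ρ g (x + 0)) - v x * mollify ρ g (x + z) :=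
    ((hvm 0).const_mul 2).sub (hvm z)
  have i2 : Integrable fun x => w (x + 0) * g (x + 0) - w (x + 0) * g (x + z) :=
    (hb 0 0).sub (hb 0 z)
  have i3 : Integrable fun x => w (x + 0) * g (x + 0) - w (x + 0) * g (x + z)
      - w (x + z) * g (x + 0) := i2.sub (hb z 0)
  rw [integral_sub i1 (hvm (-z)),
    integral_sub ((hvm 0).const_mul 2) (hvm z), integral_const_mul, hd, hd, hd,
    integral_add i3 (hb z z), integral_sub i2 (hb z 0), integral_sub (hb 0 0) (hb 0 z)]
  have t1 : ∫ x, w (x + z) * g (x + z) = ∫ x, w x * g x :=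
    integral_add_right_eq_self (fun x => w x * g x) z
  have t2 : ∫ x, w (x + z) * g x = ∫ x, w x * g (x + -z) := by
    rw [← integral_add_right_eq_self (fun x => w x * g (x + -z)) z]
    simp
  simp only [add_zero, t1, t2]
  ring

/-- Testing with the mollified negative part of a mollification: the fractional energy has a
sign. -/
theorem integral_mul_fracLaplacian_mollify_negPart_nonpos (hn : 2 ≤ n) (hs0 : 0 < s) (hs1 : s < 1)
    (h : IsMollifier A ε ρ) {v : E n → ℝ} (hv : Integrable v)
    (hgc : HasCompactSupport fun x => max (-mollify ρ v x) 0)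
    (hΦc : HasCompactSupport (mollify ρ fun x => max (-mollify ρ v x) 0)) :
    ∫ x, v x * fracLaplacian s (mollify ρ fun x => max (-mollify ρ v x) 0) x ≤ 0 := by
  have hgcont : Continuous fun x => max (-mollify ρ v x) 0 :=
    (h.contDiff_mollify hv).continuous.neg.max continuous_const
  have hgi := hgcont.integrable_of_hasCompactSupport (μ := volume) hgc
  have hΦ : ContDiff ℝ 2 (mollify ρ fun x => max (-mollify ρ v x) 0) :=
    mod_cast contDiff_infty.1 (h.contDiff_mollify hgi) 2
  rw [(integral_mul_fracLaplacian hn hs0 hs1 hΦ hΦc hv).2.2]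
  refine mul_nonpos_of_nonneg_of_nonpos (fracConst_pos hs0 hs1).le
    (mul_nonpos_of_nonneg_of_nonpos (by norm_num) (integral_nonpos fun z => ?_))
  refine div_nonpos_of_nonpos_of_nonneg ?_ (by positivity)
  rw [integral_mul_secondDiff_mollify h hv hgcont hgc]
  refine integral_nonpos fun x => ?_
  set a := mollify ρ v x
  set c := mollify ρ v (x + z)
  change (a - c) * (max (-a) 0 - max (-c) 0) ≤ 0
  -- The negative part is a decreasing function, so the two factors have opposite signs.
  rcases le_total a c with hac | hac
  · exact mul_nonpos_of_nonpos_of_nonneg (by linarith)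
      (sub_nonneg.2 (max_le_max (by linarith) le_rfl))
  · exact mul_nonpos_of_nonneg_of_nonpos (by linarith)
      (sub_nonpos.2 (max_le_max (by linarith) le_rfl))

end

/-! ### The divergence and the transport term -/

theorem differentiable_coord {F : E n → E n} {x : E n} (hF : DifferentiableAt ℝ F x) (i : Fin n) :
    DifferentiableAt ℝ (fun y => F y i) x :=
  (EuclideanSpace.proj (𝕜 := ℝ) i).differentiableAt.comp x hF

theorem fderiv_coord {F : E n → E n} {x : E n} (hF : DifferentiableAt ℝ F x) (i : Fin n) (w : E n) :
    fderiv ℝ (fun y => F y i) x w = fderiv ℝ F x w i := by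
  have := ((EuclideanSpace.proj (𝕜 := ℝ) i).hasFDerivAt (x := F x)).comp x hF.hasFDerivAt
  have h2 : fderiv ℝ (fun y => F y i) x = _ := this.fderiv
  rw [h2]
  rfl

theorem divergence_eq {F : E n → E n} {x : E n} (hF : DifferentiableAt ℝ F x) :
    divergence F x = ∑ i, fderiv ℝ F x (EuclideanSpace.single i 1) i := by
  unfold divergence
  exact Finset.sum_congr rfl fun i _ => fderiv_coord hF i _

theorem abs_divergence_le {F : E n → E n} {x : E n} (hF : DifferentiableAt ℝ F x) {K : ℝ}
    (hK : ‖fderiv ℝ F x‖ ≤ K) : |divergence F x| ≤ n * K := by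
  rw [divergence_eq hF]
  refine (Finset.abs_sum_le_sum_abs _ _).trans ?_
  have : ∀ i ∈ Finset.univ, |fderiv ℝ F x (EuclideanSpace.single i 1) i| ≤ K := by
    intro i _
    refine (PiLp.norm_apply_le (fderiv ℝ F x (EuclideanSpace.single i 1)) i).trans ?_
    refine ((fderiv ℝ F x).le_opNorm _).trans ?_
    simpa using hK
  refine (Finset.sum_le_sum this).trans ?_
  simp

theorem continuous_divergence {F : E n → E n} (hF : ContDiff ℝ 1 F) : Continuous (divergence F) := by
  have : divergence F = fun x => ∑ i, fderiv ℝ F x (EuclideanSpace.single i 1) i :=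
    funext fun x => divergence_eq (hF.differentiable one_ne_zero x)
  rw [this]
  have := hF.continuous_fderiv one_ne_zero
  fun_prop

theorem divergence_smul {φ : E n → ℝ} {F : E n → E n} {x : E n} (hφ : DifferentiableAt ℝ φ x)
    (hF : DifferentiableAt ℝ F x) :
    divergence (fun y => φ y • F y) x = fderiv ℝ φ x (F x) + φ x * divergence F x := by
  have e : fderiv ℝ φ x (F x) = ∑ i, F x i * fderiv ℝ φ x (EuclideanSpace.single i 1) := by
    conv_lhs => rw [← (EuclideanSpace.basisFun (Fin n) ℝ).sum_repr (F x)]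
    simp
  rw [e]
  unfold divergence
  rw [Finset.mul_sum, ← Finset.sum_add_distrib]
  refine Finset.sum_congr rfl fun i _ => ?_
  have hFi := differentiable_coord hF i
  have : (fun y => (φ y • F y) i) = fun y => φ y * F y i := by ext; simp
  rw [this, fderiv_fun_mul hφ hFi]
  simp
  ring

theorem divergence_eq_zero_of_notMem_tsupport {F : E n → E n} {x : E n} (hx : x ∉ tsupport F) :
    divergence F x = 0 := by
  have h0 : F =ᶠ[𝓝 x] 0 := notMem_tsupport_iff_eventuallyEq.1 hx
  unfold divergence
  refine Finset.sum_eq_zero fun i _ => ?_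
  have : (fun y => F y i) =ᶠ[𝓝 x] fun _ => (0 : ℝ) := by
    filter_upwards [h0] with y hy
    simp [hy]
  rw [this.fderiv_eq]
  simp

theorem hasCompactSupport_divergence {F : E n → E n} (hF : HasCompactSupport F) :
    HasCompactSupport (divergence F) :=
  HasCompactSupport.intro hF fun _ hx => divergence_eq_zero_of_notMem_tsupport hx

theorem integral_divergence_eq_zero {F : E n → E n} (hF : ContDiff ℝ 1 F)
    (hc : HasCompactSupport F) : ∫ x, divergence F x = 0 := by
  have hFi : ∀ i : Fin n, ContDiff ℝ 1 fun y => F y i := fun i =>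
    (EuclideanSpace.proj (𝕜 := ℝ) i).contDiff.comp hF
  have hci : ∀ i : Fin n, HasCompactSupport fun y => F y i := fun i =>
    hc.comp_left (g := fun w : E n => w i) rfl
  have hint : ∀ i : Fin n, Integrable fun x =>
      fderiv ℝ (fun y => F y i) x (EuclideanSpace.single i 1) := fun i => by
    refine Continuous.integrable_of_hasCompactSupport ?_ ?_
    · have := (hFi i).continuous_fderiv one_ne_zero
      fun_prop
    · exact (hci i).fderiv_apply (𝕜 := ℝ) _
  unfold divergence
  rw [integral_finsetSum _ fun i _ => hint i]
  refine Finset.sum_eq_zero fun i _ => ?_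
  -- Integration by parts against the constant function `1`.
  have := integral_mul_fderiv_eq_neg_fderiv_mul_of_integrable (𝕜 := ℝ) (μ := volume)
    (f := fun _ : E n => (1 : ℝ)) (g := fun y => F y i) (v := EuclideanSpace.single i 1)
    (by simp) (by simpa using hint i)
    (by simpa using (hFi i).continuous.integrable_of_hasCompactSupport (hci i))
    (by intros; fun_prop) (fun x _ => (hFi i).differentiable one_ne_zero x)
  simpa using this

/-- Half the square of the negative part is `C¹`. -/
theorem hasDerivAt_half_sq_negPart (t : ℝ) :
    HasDerivAt (fun t : ℝ => max (-t) 0 ^ 2 / 2) (-max (-t) 0) t := by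
  rcases lt_trichotomy t 0 with h | h | h
  · have : HasDerivAt (fun t : ℝ => (-t) ^ 2 / 2) (-max (-t) 0) t := by
      rw [max_eq_left (by linarith)]
      have := ((hasDerivAt_pow 2 t).div_const 2)
      simpa using this
    refine this.congr_of_eventuallyEq ?_
    filter_upwards [eventually_lt_nhds h] with x hx
    rw [max_eq_left (by linarith)]
  · subst h
    rw [neg_zero, max_self, neg_zero, hasDerivAt_iff_isLittleO]
    refine (Asymptotics.IsBigO.of_bound 1 (Eventually.of_forall fun x => ?_)).trans_isLittleO
      (Asymptotics.isLittleO_pow_id (𝕜 := ℝ) (n := 2) (by norm_num)) |>.congr_right (by simp)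
    have : max (-x) 0 ^ 2 ≤ x ^ 2 := by
      rcases le_total 0 x with hx | hx
      · rw [max_eq_right (by linarith)]; simp [sq_nonneg]
      · rw [max_eq_left (by linarith)]; simp
    simp only [neg_zero, max_self, sub_zero, smul_zero, Real.norm_eq_abs, one_mul]
    have := sq_nonneg x
    have := sq_nonneg (max (-x) 0)
    rw [abs_of_nonneg (by simp; linarith), abs_of_nonneg (sq_nonneg x)]
    simp
    linarith
  · have : HasDerivAt (fun _ : ℝ => (0 : ℝ)) (-max (-t) 0) t := by
      rw [max_eq_right (by linarith), neg_zero]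
      exact hasDerivAt_const _ _
    refine this.congr_of_eventuallyEq ?_
    filter_upwards [eventually_gt_nhds h] with x hx
    rw [max_eq_right (by linarith)]
    simp

theorem contDiff_half_sq_negPart : ContDiff ℝ 1 (fun t : ℝ => max (-t) 0 ^ 2 / 2) := by
  rw [contDiff_one_iff_deriv]
  refine ⟨fun t => (hasDerivAt_half_sq_negPart t).differentiableAt, ?_⟩
  have : deriv (fun t : ℝ => max (-t) 0 ^ 2 / 2) = fun t => -max (-t) 0 :=
    funext fun t => (hasDerivAt_half_sq_negPart t).deriv
  rw [this]
  fun_prop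

/-- The transport term tested against the negative part. -/
theorem integral_negPart_mul_fderiv {w : E n → ℝ} (hw : ContDiff ℝ 1 w) {b : E n → E n}
    (hb : ContDiff ℝ 1 b) (hbc : HasCompactSupport b) :
    ∫ x, max (-w x) 0 * fderiv ℝ w x (b x) = ∫ x, max (-w x) 0 ^ 2 / 2 * divergence b x := by
  set ψ : E n → ℝ := fun x => max (-w x) 0 ^ 2 / 2 with hψ
  have hψ1 : ContDiff ℝ 1 ψ := contDiff_half_sq_negPart.comp hw
  have hdψ : ∀ x, fderiv ℝ ψ x = (-max (-w x) 0) • fderiv ℝ w x := fun x =>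
    ((hasDerivAt_half_sq_negPart (w x)).comp_hasFDerivAt x
      (hw.differentiable one_ne_zero x).hasFDerivAt).fderiv
  have hdiv : ∀ x, divergence (fun y => ψ y • b y) x =
      -(max (-w x) 0 * fderiv ℝ w x (b x)) + ψ x * divergence b x := by
    intro x
    rw [divergence_smul (hψ1.differentiable one_ne_zero x) (hb.differentiable one_ne_zero x), hdψ]
    simp
  -- The field `ψ b` has divergence `-(max (-w) 0) ∇w · b + ψ div b`, whose integral vanishes.
  have h0 := integral_divergence_eq_zero (hψ1.smul hb) (hbc.smul_left (f := ψ))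
  have h0' : ∫ x, (-(max (-w x) 0 * fderiv ℝ w x (b x)) + ψ x * divergence b x) = 0 := by
    refine Eq.trans ?_ h0
    exact integral_congr_ae (Eventually.of_forall fun x => (hdiv x).symm)
  have hwc := hw.continuous
  have hwd := hw.continuous_fderiv one_ne_zero
  have hbcont := hb.continuous
  have i1 : Integrable fun x => max (-w x) 0 * fderiv ℝ w x (b x) := by
    refine Continuous.integrable_of_hasCompactSupport (by fun_prop) ?_
    refine HasCompactSupport.intro hbc fun x hx => ?_
    simp [image_eq_zero_of_notMem_tsupport hx]
  have i2 : Integrable fun x => ψ x * divergence b x := by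
    refine Continuous.integrable_of_hasCompactSupport
      (hψ1.continuous.mul (continuous_divergence hb)) ?_
    exact (hasCompactSupport_divergence hbc).mul_left
  have i1n : Integrable fun x => -(max (-w x) 0 * fderiv ℝ w x (b x)) := i1.neg
  rw [integral_add i1n i2, integral_neg] at h0'
  linarith

/-! ### The commutator of mollification and transport -/

/-- The kernel of the commutator of mollification with the transport operator `b · ∇`. -/
def commKernel (ρ : E n → ℝ) (b : E n → E n) (x y : E n) : ℝ :=
  fderiv ℝ ρ (x - y) (b x - b y) + ρ (x - y) * divergence b y

section

variable {A ε : ℝ} {ρ : E n → ℝ} {b : E n → E n}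

/-- Every zero of a nonnegative function is a minimum. This also covers the sphere `‖z‖ = ε`, where
`ρ` need not vanish on a neighbourhood. -/
theorem IsMollifier.fderiv_eq_zero_of_le (h : IsMollifier A ε ρ) {z : E n} (hz : ε ≤ ‖z‖) :
    fderiv ℝ ρ z = 0 := by
  refine IsLocalMin.fderiv_eq_zero (Eventually.of_forall fun y => ?_)
  rw [h.eq_zero_of_le z hz]
  exact h.nonneg y

theorem commKernel_eq_zero_of_le (h : IsMollifier A ε ρ) {x y : E n} (hxy : ε ≤ ‖x - y‖) :
    commKernel ρ b x y = 0 := by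
  simp [commKernel, h.fderiv_eq_zero_of_le hxy, h.eq_zero_of_le _ hxy]

theorem continuous_commKernel (h : IsMollifier A ε ρ) (hb : ContDiff ℝ 1 b) :
    Continuous fun q : E n × E n => commKernel ρ b q.1 q.2 := by
  have h1 := h.contDiff_one.continuous_fderiv one_ne_zero
  have h2 := h.contDiff.continuous
  have h3 := hb.continuous
  have h4 := continuous_divergence hb
  unfold commKernel
  fun_prop

/-- The Lipschitz bound on `b` gains a factor `ε` on the support of the kernel, which cancels the
extra `1 / ε` in the gradient of `ρ`. Only the scaling `ε^{-n}` of an averaging kernel remains. -/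
theorem abs_commKernel_le (h : IsMollifier A ε ρ) (hA : 0 < A) (hε : 0 < ε) {L : ℝ} (hL : 0 ≤ L)
    (hbL : ∀ x y, ‖b x - b y‖ ≤ L * ‖x - y‖) {D : ℝ} (hD : ∀ x, |divergence b x| ≤ D)
    (x y : E n) : |commKernel ρ b x y| ≤ A * (L + D) / ε ^ n := by
  have hD0 : 0 ≤ D := (abs_nonneg _).trans (hD 0)
  rcases le_or_gt ε ‖x - y‖ with hxy | hxy
  · rw [commKernel_eq_zero_of_le h hxy, abs_zero]
    positivity
  · refine (abs_add_le _ _).trans ?_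
    have t1 : |fderiv ℝ ρ (x - y) (b x - b y)| ≤ A / ε ^ n / ε * (L * ε) := by
      refine ((fderiv ℝ ρ (x - y)).le_opNorm _).trans ?_
      gcongr
      · exact h.norm_fderiv_le _
      · exact (hbL x y).trans (by gcongr)
    have t2 : |ρ (x - y) * divergence b y| ≤ A / ε ^ n * D := by
      rw [abs_mul]
      gcongr
      · exact h.abs_le _
      · exact hD y
    refine (add_le_add t1 t2).trans (le_of_eq ?_)
    field_simp

/-- In the variable `y` the kernel is the divergence of the compactly supported field `ρ(x - y)
(b(y) - b(x))`. -/
theorem integral_commKernel (h : IsMollifier A ε ρ) (hb : ContDiff ℝ 1 b) (x : E n) :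
    ∫ y, commKernel ρ b x y = 0 := by
  have hρx : ContDiff ℝ 1 fun y => ρ (x - y) := h.contDiff_one.comp (contDiff_const.sub contDiff_id)
  have hbx : ContDiff ℝ 1 fun y => b y - b x := hb.sub contDiff_const
  have hc : HasCompactSupport fun y => ρ (x - y) • (b y - b x) := by
    refine HasCompactSupport.intro (isCompact_closedBall x ε) fun y hy => ?_
    rw [h.eq_zero_of_le, zero_smul]
    rw [← dist_eq_norm, dist_comm]
    exact (not_le.1 (by simpa using hy)).le
  rw [← integral_divergence_eq_zero (hρx.smul hbx) hc]
  refine integral_congr_ae (Eventually.of_forall fun y => ?_)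
  have e := divergence_smul (hρx.differentiable one_ne_zero y) (hbx.differentiable one_ne_zero y)
  have e1 : fderiv ℝ (fun y => ρ (x - y)) y = -fderiv ℝ ρ (x - y) := by
    have := ((h.contDiff_one.differentiable one_ne_zero (x - y)).hasFDerivAt).comp y
      ((hasFDerivAt_id y).const_sub x)
    have h2 : fderiv ℝ (fun y => ρ (x - y)) y = _ := this.fderiv
    rw [h2]
    ext w
    simp
  have e2 : divergence (fun y => b y - b x) y = divergence b y := by
    rw [divergence_eq (hbx.differentiable one_ne_zero y),
      divergence_eq (hb.differentiable one_ne_zero y), fderiv_sub_const]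
  rw [e1, e2] at e
  refine Eq.trans ?_ e.symm
  simp only [commKernel, _root_.neg_apply, ← map_neg, neg_sub]

theorem integrable_prod_mul_of_bdd {f g : E n → ℝ} (hf : Integrable f)
    (hg : Integrable g) {J : E n × E n → ℝ} (hJ : Continuous J) {B : ℝ} (hB : ∀ q, |J q| ≤ B) :
    Integrable (fun q : E n × E n => f q.1 * (g q.2 * J q)) (volume.prod volume) := by
  have := (hf.mul_prod hg).mul_bdd (c := B) (f := fun q : E n × E n => f q.1 * g q.2)
    hJ.aestronglyMeasurable (Eventually.of_forall fun q => hB q)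
  simpa only [mul_assoc] using this

/-- Commuting mollification and transport. -/
theorem integral_mul_divergence_mollify (h : IsMollifier A ε ρ) (hb : ContDiff ℝ 1 b)
    (hbc : HasCompactSupport b) {B : ℝ} (hB : ∀ x y, |commKernel ρ b x y| ≤ B)
    {v g : E n → ℝ} (hv : Integrable v) (hg : Continuous g) (hgc : HasCompactSupport g) :
    ∫ y, v y * divergence (fun y => mollify ρ g y • b y) y =
      (∫ x, g x * ∫ y, v y * commKernel ρ b x y) -
        ∫ x, g x * fderiv ℝ (mollify ρ v) x (b x) := by
  have hgi : Integrable g := hg.integrable_of_hasCompactSupport hgc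
  have hdc := h.contDiff_one.continuous_fderiv one_ne_zero
  have hbcont := hb.continuous
  obtain ⟨b₀, hb₀⟩ := hbcont.bounded_above_of_compact_support hbc
  set D : E n × E n → ℝ := fun q => fderiv ℝ ρ (q.1 - q.2) (b q.1) with hD
  have hDc : Continuous D := by fun_prop
  have hDb : ∀ q, |D q| ≤ A / ε ^ n / ε * b₀ := fun q =>
    ((fderiv ℝ ρ (q.1 - q.2)).le_opNorm _).trans
      (mul_le_mul (h.norm_fderiv_le _) (hb₀ _) (norm_nonneg _)
        ((norm_nonneg _).trans (h.norm_fderiv_le 0)))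
  have hKc := continuous_commKernel h hb
  have hK : Integrable (fun q : E n × E n => g q.1 * (v q.2 * commKernel ρ b q.1 q.2))
      (volume.prod volume) := integrable_prod_mul_of_bdd hgi hv hKc fun q => hB _ _
  have hDi : Integrable (fun q : E n × E n => g q.1 * (v q.2 * D q))
      (volume.prod volume) := integrable_prod_mul_of_bdd hgi hv hDc hDb
  have e1 : ∀ y, v y * divergence (fun y => mollify ρ g y • b y) y =
      ∫ x, (g x * (v y * commKernel ρ b x y) - g x * (v y * D (x, y))) := by
    intro y
    have hm1 : ContDiff ℝ 1 (mollify ρ g) :=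
      (h.contDiff_mollify hgi).of_le (by exact_mod_cast le_top)
    have i1 : Integrable fun x => g x * fderiv ℝ ρ (y - x) (b y) := by
      refine hgi.mul_bdd (c := A / ε ^ n / ε * b₀) ?_ (Eventually.of_forall fun x => ?_)
      · exact Continuous.aestronglyMeasurable (by fun_prop)
      · exact ((fderiv ℝ ρ (y - x)).le_opNorm _).trans
          (mul_le_mul (h.norm_fderiv_le _) (hb₀ _) (norm_nonneg _)
            ((norm_nonneg _).trans (h.norm_fderiv_le 0)))
    rw [divergence_smul (hm1.differentiable one_ne_zero y) (hb.differentiable one_ne_zero y),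
      h.fderiv_mollify hgi, mollify, ← integral_mul_const,
      ← integral_add i1 ((h.integrable_mul hgi y).mul_const _), ← integral_const_mul]
    refine integral_congr_ae (Eventually.of_forall fun x => ?_)
    simp only [commKernel, hD, h.fderiv_sub_comm y x, map_sub, h.even_sub y x,
      _root_.neg_apply]
    ring
  have e2 : ∀ x, (∫ y, (g x * (v y * commKernel ρ b x y))) = g x * ∫ y, v y * commKernel ρ b x y :=
    fun x => integral_const_mul _ _
  have e3 : ∀ x, (∫ y, (g x * (v y * D (x, y)))) = g x * fderiv ℝ (mollify ρ v) x (b x) := by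
    intro x
    rw [h.fderiv_mollify hv, integral_const_mul]
  have hKD : Integrable (fun q : E n × E n => g q.1 * (v q.2 * commKernel ρ b q.1 q.2) -
      g q.1 * (v q.2 * D q)) (volume.prod volume) := hK.sub hDi
  simp_rw [e1, ← e2, ← e3]
  rw [← integral_integral_swap hKD]
  exact integral_integral_sub hK hDi

theorem enorm_integral_sub_mul_le {v : E n → ℝ} {J : E n → ℝ} {x : E n} {B : ℝ}
    (hB : ∀ y, |J y| ≤ B) (h0 : ∀ y, ε ≤ ‖x - y‖ → J y = 0) :
    ‖∫ y, (v y - v x) * J y‖ₑ ≤ ENNReal.ofReal B * ∫⁻ y in Metric.ball x ε, ‖v y - v x‖ₑ := by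
  refine (enorm_integral_le_lintegral_enorm _).trans ?_
  rw [← lintegral_const_mul' _ _ ENNReal.ofReal_ne_top, ← lintegral_indicator measurableSet_ball]
  refine lintegral_mono fun y => ?_
  by_cases hy : y ∈ Metric.ball x ε
  · rw [Set.indicator_of_mem hy, enorm_mul, mul_comm]
    gcongr
    rw [Real.enorm_eq_ofReal_abs]
    exact ENNReal.ofReal_le_ofReal (hB y)
  · have : J y = 0 := h0 y (by
      rw [← dist_eq_norm, dist_comm]
      simpa using hy)
    simp [this]

/-- Since the kernel has mean zero, `v y` may be replaced by `v y - v x`. The commutator is thus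
controlled by the local oscillation of `v`, which is small in `L¹`, without differentiating `v`. -/
theorem enorm_integral_commKernel_le (h : IsMollifier A ε ρ) (hb : ContDiff ℝ 1 b) {B : ℝ}
    (hB : ∀ x y, |commKernel ρ b x y| ≤ B) {v : E n → ℝ} (hv : Integrable v) (x : E n) :
    ‖∫ y, v y * commKernel ρ b x y‖ₑ ≤
      ENNReal.ofReal B * ∫⁻ y in Metric.ball x ε, ‖v y - v x‖ₑ := by
  have hKc : Continuous fun y => commKernel ρ b x y :=
    (continuous_commKernel h hb).comp (by fun_prop : Continuous fun y => (x, y))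
  have i1 : Integrable fun y => v y * commKernel ρ b x y :=
    hv.mul_bdd (c := B) hKc.aestronglyMeasurable (Eventually.of_forall fun y => hB x y)
  have i2 : Integrable fun y => commKernel ρ b x y := by
    refine hKc.integrable_of_hasCompactSupport
      (HasCompactSupport.intro (isCompact_closedBall x ε) fun y hy => ?_)
    refine commKernel_eq_zero_of_le h ?_
    rw [← dist_eq_norm, dist_comm]
    exact (not_le.1 (by simpa using hy)).le
  have e : ∫ y, v y * commKernel ρ b x y = ∫ y, (v y - v x) * commKernel ρ b x y := by
    simp_rw [sub_mul]
    rw [integral_sub i1 (i2.const_mul _), integral_const_mul, integral_commKernel h hb]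
    simp
  rw [e]
  exact enorm_integral_sub_mul_le (hB x) fun y hy => commKernel_eq_zero_of_le h hy

theorem enorm_mollify_sub_le (h : IsMollifier A ε ρ) {v : E n → ℝ} (hv : Integrable v) (x : E n) :
    ‖mollify ρ v x - v x‖ₑ ≤
      ENNReal.ofReal (A / ε ^ n) * ∫⁻ y in Metric.ball x ε, ‖v y - v x‖ₑ := by
  have e : mollify ρ v x - v x = ∫ y, (v y - v x) * ρ (x - y) := by
    simp_rw [sub_mul]
    rw [integral_sub (h.integrable_mul hv x) ((h.integrable.comp_sub_left x).const_mul _),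
      integral_const_mul, integral_sub_left_eq_self ρ volume x, h.integral_eq_one, mul_one, mollify]
  rw [e]
  exact enorm_integral_sub_mul_le (fun y => h.abs_le _) fun y hy => h.eq_zero_of_le _ hy

end

/-! ### The weak maximum principle -/

theorem hasCompactSupport_of_eq_zero {X : Type*} [Zero X] {f : E n → X} {x₀ : E n} {R : ℝ}
    (hf : ∀ x, x ∉ Metric.ball x₀ R → f x = 0) : HasCompactSupport f :=
  HasCompactSupport.intro (isCompact_closedBall x₀ R) fun x hx =>
    hf x fun h => hx (Metric.ball_subset_closedBall h)

theorem tsupport_subset_closedBall {X : Type*} [Zero X] {f : E n → X} {x₀ : E n} {R : ℝ}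
    (hf : ∀ x, x ∉ Metric.ball x₀ R → f x = 0) : tsupport f ⊆ Metric.closedBall x₀ R := by
  refine closure_minimal (fun x hx => ?_) Metric.isClosed_closedBall
  by_contra h
  exact hx (hf x fun h' => h (Metric.ball_subset_closedBall h'))

theorem integrable_sq_of_hasCompactSupport {g : E n → ℝ} (hg : Continuous g)
    (hgc : HasCompactSupport g) : Integrable fun x => g x ^ 2 :=
  (hg.pow 2).integrable_of_hasCompactSupport
    (HasCompactSupport.intro hgc fun x hx => by simp [image_eq_zero_of_notMem_tsupport hx])

/-- The energy estimate for one mollification. -/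
theorem integral_negPart_sq_le (hn : 2 ≤ n) (hs0 : 0 < s) (hs1 : s < 1)
    {A ε : ℝ} {ρ : E n → ℝ} (h : IsMollifier A ε ρ) {v : E n → ℝ} (hv : Integrable v)
    {x₀ : E n} {R₁ R₂ : ℝ} (h12 : R₁ + 2 * ε ≤ R₂) (hε : 0 < ε)
    (hv0 : ∀ᵐ x, x ∉ Metric.ball x₀ R₁ → 0 ≤ v x) {b : E n → E n}
    (hb : ContDiff ℝ 1 b) (hbc : HasCompactSupport b)
    {B : ℝ} (hB : ∀ x y, |commKernel ρ b x y| ≤ B) {N : ℝ}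
    (hdiv : ∀ x ∈ Metric.ball x₀ R₂, divergence b x ≤ 2 * (N - 1))
    (htest : ∀ Φ : E n → ℝ, ContDiff ℝ (⊤ : ℕ∞) Φ → (∀ x, 0 ≤ Φ x) →
      tsupport Φ ⊆ Metric.closedBall x₀ R₂ →
      0 ≤ (∫ x, v x * fracLaplacian s Φ x) - (∫ x, v x * divergence (fun y => Φ y • b y) x)
        + N * ∫ x, v x * Φ x) :
    HasCompactSupport (fun x => max (-mollify ρ v x) 0) ∧
    ∫ x, max (-mollify ρ v x) 0 ^ 2 ≤
      -∫ x, max (-mollify ρ v x) 0 * ∫ y, v y * commKernel ρ b x y := by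
  set w := mollify ρ v with hw
  set g : E n → ℝ := fun x => max (-w x) 0 with hg
  have hwsm : ContDiff ℝ (⊤ : ℕ∞) w := h.contDiff_mollify hv
  have hgcont : Continuous g := hwsm.continuous.neg.max continuous_const
  have hg0 : ∀ x, x ∉ Metric.ball x₀ (R₁ + ε) → g x = 0 := by
    intro x hx
    have : 0 ≤ w x := by
      refine h.le_mollify hv ?_
      filter_upwards [hv0] with y hy hxy
      refine hy fun hyb => hx ?_
      rw [Metric.mem_ball] at hyb ⊢
      rw [← dist_eq_norm] at hxy
      linarith [dist_triangle x y x₀]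
    simpa [hg] using this
  have hgc : HasCompactSupport g := hasCompactSupport_of_eq_zero hg0
  refine ⟨hgc, ?_⟩
  have hgi : Integrable g := hgcont.integrable_of_hasCompactSupport hgc
  have hΦ0 : ∀ x, x ∉ Metric.ball x₀ R₂ → mollify ρ g x = 0 := by
    intro x hx
    refine h.mollify_eq_zero fun y hxy => hg0 y fun hyb => hx ?_
    rw [Metric.mem_ball] at hyb ⊢
    rw [← dist_eq_norm] at hxy
    linarith [dist_triangle x y x₀]
  have hΦc : HasCompactSupport (mollify ρ g) := hasCompactSupport_of_eq_zero hΦ0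
  -- The two mollifications, one inside `g` and one around it, each widen the support by `ε`; this
  -- is why `R₁ + 2ε ≤ R₂` is assumed.
  have key := htest (mollify ρ g) (h.contDiff_mollify hgi)
    (h.mollify_nonneg fun y => le_max_right _ _) (tsupport_subset_closedBall hΦ0)
  have k1 : ∫ x, v x * fracLaplacian s (mollify ρ g) x ≤ 0 :=
    integral_mul_fracLaplacian_mollify_negPart_nonpos hn hs0 hs1 h hv hgc hΦc
  have k2 := integral_mul_divergence_mollify h hb hbc hB hv hgcont hgc
  have k3 : ∫ x, g x * fderiv ℝ w x (b x) = ∫ x, g x ^ 2 / 2 * divergence b x :=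
    integral_negPart_mul_fderiv (hwsm.of_le (by exact_mod_cast le_top)) hb hbc
  have k4 : ∫ x, v x * mollify ρ g x = -∫ x, g x ^ 2 := by
    rw [h.integral_mul_mollify hv hgi, ← integral_neg]
    refine integral_congr_ae (Eventually.of_forall fun x => ?_)
    change w x * max (-w x) 0 = -max (-w x) 0 ^ 2
    rcases le_total 0 (w x) with hx | hx
    · rw [max_eq_right (by linarith)]; simp
    · rw [max_eq_left (by linarith)]; ring
  have hgdc : Continuous fun x => g x ^ 2 / 2 * divergence b x :=
    ((hgcont.pow 2).div_const 2).mul (continuous_divergence hb)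
  -- Bounding the divergence by `2(N - 1)` rather than `2N` leaves one full copy of `∫ g²` after
  -- cancellation with the zeroth order term.
  have k5 : ∫ x, g x ^ 2 / 2 * divergence b x ≤ ∫ x, (N - 1) * g x ^ 2 := by
    refine integral_mono (hgdc.integrable_of_hasCompactSupport
      (hasCompactSupport_divergence hbc).mul_left)
      ((integrable_sq_of_hasCompactSupport hgcont hgc).const_mul _) fun x => ?_
    by_cases hx : x ∈ Metric.ball x₀ R₂
    · have := mul_le_mul_of_nonneg_left (hdiv x hx) (by positivity : 0 ≤ g x ^ 2 / 2)
      change g x ^ 2 / 2 * divergence b x ≤ (N - 1) * g x ^ 2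
      linarith
    · have : g x = 0 := hg0 x fun h' => hx (Metric.ball_subset_ball (by linarith) h')
      simp [this]
  rw [integral_const_mul] at k5
  rw [k2, k3, k4] at key
  change ∫ x, g x ^ 2 ≤ -∫ x, g x * ∫ y, v y * commKernel ρ b x y
  linarith

/-- Weak maximum principle for integrable functions whose negative part is bounded and supported
in a smaller ball. -/
theorem ae_nonneg_of_forall_test (hn : 2 ≤ n) (hs0 : 0 < s) (hs1 : s < 1)
    {v : E n → ℝ} (hv : Integrable v) {k : ℝ} (hk : 0 ≤ k) (hvk : ∀ᵐ x, -k ≤ v x)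
    {x₀ : E n} {R₁ R₂ : ℝ} (h12 : R₁ < R₂)
    (hv0 : ∀ᵐ x, x ∉ Metric.ball x₀ R₁ → 0 ≤ v x) {b : E n → E n}
    (hb : ContDiff ℝ 1 b) (hbc : HasCompactSupport b) {N : ℝ}
    (hdiv : ∀ x ∈ Metric.ball x₀ R₂, divergence b x ≤ 2 * (N - 1))
    (htest : ∀ Φ : E n → ℝ, ContDiff ℝ (⊤ : ℕ∞) Φ → (∀ x, 0 ≤ Φ x) →
      tsupport Φ ⊆ Metric.closedBall x₀ R₂ →
      0 ≤ (∫ x, v x * fracLaplacian s Φ x) - (∫ x, v x * divergence (fun y => Φ y • b y) x)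
        + N * ∫ x, v x * Φ x) :
    ∀ᵐ x, 0 ≤ v x := by
  obtain ⟨A, hA, hρ⟩ := exists_isMollifier n
  obtain ⟨L, hL⟩ := hb.lipschitzWith_of_hasCompactSupport hbc one_ne_zero
  obtain ⟨D, hD⟩ := (continuous_divergence hb).bounded_above_of_compact_support
    (hasCompactSupport_divergence hbc)
  set B := A * (L + D) with hBdef
  set C : ENNReal := ENNReal.ofReal (k * B) + ENNReal.ofReal (2 * k * A) with hC
  have hB0 : 0 ≤ B := by
    have : 0 ≤ D := (norm_nonneg _).trans (hD 0)
    positivity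
  -- The constant `C` is independent of the scale `ε` chosen for `δ`, so `δ` may afterwards be sent
  -- to zero.
  have main : ∀ δ : ENNReal, δ ≠ 0 → ∫⁻ x, ENNReal.ofReal (max (-v x) 0 ^ 2) ≤ δ * C := by
    intro δ hδ
    obtain ⟨ε₀, hε₀, hosc⟩ := exists_lintegral_oscillation_le hv hδ
    obtain ⟨ε, hε, hεlt⟩ := exists_between (lt_min hε₀ (half_pos (sub_pos.2 h12)))
    have hε1 := hεlt.trans_le (min_le_left _ _)
    have hε2 := hεlt.trans_le (min_le_right _ _)
    obtain ⟨ρ, h⟩ := hρ ε hε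
    have hB : ∀ x y, |commKernel ρ b x y| ≤ B / ε ^ n :=
      abs_commKernel_le h hA hε L.2 (fun x y => hL.norm_sub_le x y) hD
    obtain ⟨hgc, hsq⟩ := integral_negPart_sq_le hn hs0 hs1 h hv (by linarith) hε hv0 hb hbc hB
      hdiv htest
    set w := mollify ρ v with hw
    have hwc : Continuous w := (h.contDiff_mollify hv).continuous
    have hgcont : Continuous fun x => max (-w x) 0 := hwc.neg.max continuous_const
    have hwk : ∀ x, max (-w x) 0 ≤ k := by
      intro x
      refine max_le ?_ hk
      have : -k ≤ w x := h.le_mollify hv (hvk.mono fun y hy _ => hy)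
      linarith
    have hscale : ∀ a : ℝ, 0 ≤ a → ENNReal.ofReal (a / ε ^ n) *
        ∫⁻ x, ∫⁻ y in Metric.ball x ε, ‖v y - v x‖ₑ ≤ δ * ENNReal.ofReal a := by
      intro a ha
      calc _ ≤ ENNReal.ofReal (a / ε ^ n) * (ENNReal.ofReal (ε ^ n) * δ) := by
            gcongr
            exact hosc ε hε hε1
        _ = δ * ENNReal.ofReal a := by
            rw [← mul_assoc, ← ENNReal.ofReal_mul (by positivity),
              div_mul_cancel₀ _ (by positivity), mul_comm]
    have p1 : ∫⁻ x, ENNReal.ofReal (max (-w x) 0 ^ 2) ≤ δ * ENNReal.ofReal (k * B) := by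
      rw [← ofReal_integral_eq_lintegral_ofReal (integrable_sq_of_hasCompactSupport hgcont hgc)
        (Eventually.of_forall fun x => sq_nonneg _)]
      calc ENNReal.ofReal (∫ x, max (-w x) 0 ^ 2)
          ≤ ‖∫ x, max (-w x) 0 * ∫ y, v y * commKernel ρ b x y‖ₑ := by
            rw [Real.enorm_eq_ofReal_abs]
            exact ENNReal.ofReal_le_ofReal (hsq.trans (neg_le_abs _))
        _ ≤ ∫⁻ x, ‖max (-w x) 0 * ∫ y, v y * commKernel ρ b x y‖ₑ :=
            enorm_integral_le_lintegral_enorm _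
        _ ≤ ∫⁻ x, ENNReal.ofReal (k * B / ε ^ n) *
              ∫⁻ y in Metric.ball x ε, ‖v y - v x‖ₑ := by
            refine lintegral_mono fun x => ?_
            rw [enorm_mul, mul_div_assoc, ENNReal.ofReal_mul hk, mul_assoc]
            refine mul_le_mul' ?_ (enorm_integral_commKernel_le h hb hB hv x)
            rw [Real.enorm_eq_ofReal (le_max_right _ _)]
            exact ENNReal.ofReal_le_ofReal (hwk x)
        _ ≤ δ * ENNReal.ofReal (k * B) := by
            rw [lintegral_const_mul' _ _ ENNReal.ofReal_ne_top]
            exact hscale _ (by positivity)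
    have p2 : ∫⁻ x, ENNReal.ofReal (2 * k * |w x - v x|) ≤ δ * ENNReal.ofReal (2 * k * A) := by
      calc ∫⁻ x, ENNReal.ofReal (2 * k * |w x - v x|)
          ≤ ∫⁻ x, ENNReal.ofReal (2 * k * A / ε ^ n) *
              ∫⁻ y in Metric.ball x ε, ‖v y - v x‖ₑ := by
            refine lintegral_mono fun x => ?_
            rw [ENNReal.ofReal_mul (by positivity), mul_div_assoc,
              ENNReal.ofReal_mul (p := 2 * k) (by positivity), mul_assoc, ← Real.enorm_eq_ofReal_abs]
            gcongr
            exact enorm_mollify_sub_le h hv x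
        _ ≤ δ * ENNReal.ofReal (2 * k * A) := by
            rw [lintegral_const_mul' _ _ ENNReal.ofReal_ne_top]
            exact hscale _ (by positivity)
    have hmeas : AEMeasurable fun x => ENNReal.ofReal (max (-w x) 0 ^ 2) :=
      (hgcont.pow 2).measurable.ennreal_ofReal.aemeasurable
    calc ∫⁻ x, ENNReal.ofReal (max (-v x) 0 ^ 2)
        ≤ ∫⁻ x, (ENNReal.ofReal (max (-w x) 0 ^ 2) + ENNReal.ofReal (2 * k * |w x - v x|)) := by
          refine lintegral_mono_ae ?_
          filter_upwards [hvk] with x hx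
          rw [← ENNReal.ofReal_add (sq_nonneg _) (by positivity)]
          refine ENNReal.ofReal_le_ofReal ?_
          have a1 : max (-v x) 0 ≤ k := max_le (by linarith) hk
          have a2 := hwk x
          -- Both negative parts lie in `[0, k]`, so their squares differ by at most `2k` times
          -- their difference. This allows passing from `w` back to `v` with `L¹` convergence alone.
          have a3 : |max (-v x) 0 - max (-w x) 0| ≤ |w x - v x| := by
            refine (abs_max_sub_max_le_abs _ _ _).trans (le_of_eq ?_)
            congr 1
            ring
          have a4 : 0 ≤ max (-v x) 0 := le_max_right _ _
          have a5 : 0 ≤ max (-w x) 0 := le_max_right _ _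
          have a6 := (abs_le.1 a3).2
          nlinarith [abs_nonneg (w x - v x)]
      _ = (∫⁻ x, ENNReal.ofReal (max (-w x) 0 ^ 2)) +
          ∫⁻ x, ENNReal.ofReal (2 * k * |w x - v x|) := lintegral_add_left' hmeas _
      _ ≤ δ * C := by
          rw [hC, mul_add]
          exact add_le_add p1 p2
  have hzero : ∫⁻ x, ENNReal.ofReal (max (-v x) 0 ^ 2) = 0 := by
    by_contra hne
    obtain ⟨a, ha0, ha⟩ := ENNReal.exists_nnreal_pos_mul_lt (a := C) (by simp [hC]) hne
    exact absurd (main a (by simpa using ha0.ne')) (not_le.2 ha)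
  have hvm : AEMeasurable fun x => ENNReal.ofReal (max (-v x) 0 ^ 2) :=
    ((hv.aestronglyMeasurable.aemeasurable.neg.max aemeasurable_const).pow_const 2).ennreal_ofReal
  filter_upwards [(lintegral_eq_zero_iff' hvm).1 hzero] with x hx
  have h1 : max (-v x) 0 ^ 2 ≤ 0 := by simpa using hx
  have h2 : max (-v x) 0 = 0 := by simpa using h1.antisymm (sq_nonneg _)
  have := le_max_left (-v x) 0
  linarith

/-! ### Kernel estimates at scale `r` -/

/-- The mass of the kernel `|z|^{-n-2s}` outside the ball of radius `1/16`. -/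
def kernelTail (n : ℕ) (s : ℝ) : ℝ :=
  ∫ z in (Metric.closedBall (0 : E n) (1 / 16))ᶜ, 1 / ‖z‖ ^ ((n : ℝ) + 2 * s)

theorem kernelTail_nonneg : 0 ≤ kernelTail n s :=
  integral_nonneg fun z => by positivity

theorem integral_kernelTail_scaled {r : ℝ} (hr : 0 < r) :
    ∫ z in (Metric.closedBall (0 : E n) (r / 16))ᶜ, 1 / ‖z‖ ^ ((n : ℝ) + 2 * s) =
      r ^ (-(2 * s)) * kernelTail n s := by
  have hms : ∀ t : ℝ, MeasurableSet (Metric.closedBall (0 : E n) t)ᶜ := fun t =>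
    Metric.isClosed_closedBall.measurableSet.compl
  set F : E n → ℝ := (Metric.closedBall (0 : E n) (1 / 16))ᶜ.indicator
    fun z => 1 / ‖z‖ ^ ((n : ℝ) + 2 * s) with hF
  have e : ∀ z : E n, (Metric.closedBall (0 : E n) (r / 16))ᶜ.indicator
      (fun z => 1 / ‖z‖ ^ ((n : ℝ) + 2 * s)) z = r ^ (-((n : ℝ) + 2 * s)) * F (r⁻¹ • z) := by
    intro z
    have hnorm : ‖r⁻¹ • z‖ = r⁻¹ * ‖z‖ := by
      rw [norm_smul, norm_inv, Real.norm_of_nonneg hr.le]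
    have hiff : r⁻¹ • z ∈ (Metric.closedBall (0 : E n) (1 / 16))ᶜ ↔
        z ∈ (Metric.closedBall (0 : E n) (r / 16))ᶜ := by
      simp only [Set.mem_compl_iff, Metric.mem_closedBall, dist_zero_right, hnorm]
      rw [inv_mul_le_iff₀ hr, mul_one_div]
    by_cases hz : z ∈ (Metric.closedBall (0 : E n) (r / 16))ᶜ
    · rw [Set.indicator_of_mem hz, hF, Set.indicator_of_mem (hiff.2 hz), hnorm,
        Real.mul_rpow (by positivity) (norm_nonneg _), Real.inv_rpow hr.le, Real.rpow_neg hr.le]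
      have : r ^ ((n : ℝ) + 2 * s) ≠ 0 := (Real.rpow_pos_of_pos hr _).ne'
      field_simp
    · rw [Set.indicator_of_notMem hz, hF, Set.indicator_of_notMem fun h => hz (hiff.1 h), mul_zero]
  rw [← integral_indicator (hms _)]
  simp_rw [e]
  rw [integral_const_mul, Measure.integral_comp_inv_smul_of_nonneg _ _ hr.le, kernelTail,
    ← integral_indicator (hms _), smul_eq_mul, ← mul_assoc]
  congr 1
  simp only [finrank_euclideanSpace, Fintype.card_fin]
  rw [← Real.rpow_natCast r n, ← Real.rpow_add hr]
  congr 1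
  ring

section

variable {Φ : E n → ℝ} {x₀ : E n} {r : ℝ}

/-- This is the pairing of `Φ` with the fractional Laplacian of the indicator of `S`. For `‖z‖ ≤
r/16` the translates of `Φ` by `±z` stay supported in `S`, as `5/8 + 1/16 < 3/4`, so the second
difference integrates to zero. For larger `z` the nonpositive terms are dropped, and only the tail
of the kernel counts. -/
theorem setIntegral_fracLaplacian_le (hn : 2 ≤ n) (hs0 : 0 < s) (hs1 : s < 1) (hr : 0 < r)
    (hΦ : ContDiff ℝ (⊤ : ℕ∞) Φ) (hΦ0 : ∀ x, 0 ≤ Φ x)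
    (hsupp : ∀ x, 5 * r / 8 < dist x x₀ → Φ x = 0) :
    ∫ x in Metric.ball x₀ (3 * r / 4), fracLaplacian s Φ x ≤
      fracConst n s * ((∫ x, Φ x) * (r ^ (-(2 * s)) * kernelTail n s)) := by
  set S := Metric.ball x₀ (3 * r / 4) with hS
  have hSm : MeasurableSet S := measurableSet_ball
  have hΦc : HasCompactSupport Φ := HasCompactSupport.intro (isCompact_closedBall x₀ (5 * r / 8))
    fun x hx => hsupp x (not_le.1 (by simpa using hx))
  have hΦi : Integrable Φ := hΦ.continuous.integrable_of_hasCompactSupport hΦc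
  have hΦ2 : ContDiff ℝ 2 Φ := mod_cast contDiff_infty.1 hΦ 2
  have hw : Integrable (S.indicator fun _ => (1 : ℝ)) :=
    (integrable_indicator_iff hSm).2 (integrableOn_const measure_ball_lt_top.ne)
  obtain ⟨-, h2, h3⟩ := integral_mul_fracLaplacian hn hs0 hs1 hΦ2 hΦc hw
  have e0 : ∫ x in S, fracLaplacian s Φ x =
      ∫ x, S.indicator (fun _ => (1 : ℝ)) x * fracLaplacian s Φ x := by
    rw [← integral_indicator hSm]
    congr 1
    ext x
    by_cases hx : x ∈ S <;> simp [hx]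
  rw [e0, h3]
  have hI : 0 ≤ ∫ x, Φ x := integral_nonneg hΦ0
  have hshift : ∀ z, ∫ x, Φ (x + z) = ∫ x, Φ x := fun z => integral_add_right_eq_self Φ z
  have hip : ∀ z, Integrable fun x => Φ (x + z) := fun z => hΦi.comp_add_right z
  have hinner : ∀ z : E n, (∫ x, S.indicator (fun _ => (1 : ℝ)) x * secondDiff Φ x z) ≤
      (Metric.closedBall (0 : E n) (r / 16))ᶜ.indicator (fun _ => 2 * ∫ x, Φ x) z := by
    intro z
    by_cases hz : ‖z‖ ≤ r / 16
    · rw [Set.indicator_of_notMem (by simpa using hz)]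
      have : ∀ x, S.indicator (fun _ => (1 : ℝ)) x * secondDiff Φ x z =
          2 * Φ x - Φ (x + z) - Φ (x + -z) := by
        intro x
        by_cases hx : x ∈ S
        · simp [hx, secondDiff, sub_eq_add_neg]
        · have hx' : 3 * r / 4 ≤ dist x x₀ := by simpa [hS] using hx
          have a0 : Φ x = 0 := hsupp x (by linarith)
          have a1 : Φ (x + z) = 0 := hsupp _ (by
            have := dist_triangle x (x + z) x₀
            rw [dist_eq_norm x (x + z)] at this
            simp only [sub_add_cancel_left, norm_neg] at this
            linarith)
          have a2 : Φ (x + -z) = 0 := hsupp _ (by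
            have := dist_triangle x (x + -z) x₀
            rw [dist_eq_norm x (x + -z)] at this
            simp only [sub_add_cancel_left, norm_neg] at this
            linarith)
          simp [hx, a0, a1, a2]
      simp_rw [this]
      have i1 : Integrable fun x => 2 * Φ x - Φ (x + z) := (hΦi.const_mul 2).sub (hip z)
      rw [integral_sub i1 (hip _), integral_sub (hΦi.const_mul 2) (hip z), integral_const_mul,
        hshift, hshift]
      linarith
    · rw [Set.indicator_of_mem (by simpa using hz), ← integral_const_mul]
      have i1 : Integrable fun x => secondDiff Φ x z := by
        simp only [secondDiff, sub_eq_add_neg _ z]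
        exact ((hΦi.const_mul 2).sub (hip z)).sub (hip (-z))
      have e1 : (fun x => S.indicator (fun _ => (1 : ℝ)) x * secondDiff Φ x z) =
          S.indicator fun x => secondDiff Φ x z := by
        ext x
        by_cases hx : x ∈ S <;> simp [hx]
      rw [e1]
      refine integral_mono (i1.indicator hSm) (hΦi.const_mul 2) fun x => ?_
      have a0 := hΦ0 x
      have a1 := hΦ0 (x + z)
      have a2 := hΦ0 (x - z)
      by_cases hx : x ∈ S
      · simp only [Set.indicator_of_mem hx, secondDiff]
        linarith
      · simp only [Set.indicator_of_notMem hx]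
        positivity
  have hstep : ∫ z, (∫ x, S.indicator (fun _ => (1 : ℝ)) x * secondDiff Φ x z) /
      ‖z‖ ^ ((n : ℝ) + 2 * s) ≤ 2 * (∫ x, Φ x) * (r ^ (-(2 * s)) * kernelTail n s) := by
    rw [← integral_kernelTail_scaled hr, ← integral_const_mul,
      ← integral_indicator Metric.isClosed_closedBall.measurableSet.compl]
    refine integral_mono h2 ?_ fun z => ?_
    · exact (integrable_indicator_iff Metric.isClosed_closedBall.measurableSet.compl).2
        ((integrableOn_div_rpow_compl_closedBall hn hs0 hs1 (by positivity)).const_mul _)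
    · have hz := hinner z
      have hp : 0 ≤ ‖z‖ ^ ((n : ℝ) + 2 * s) := by positivity
      refine (div_le_div_of_nonneg_right hz hp).trans (le_of_eq ?_)
      by_cases hz : z ∈ (Metric.closedBall (0 : E n) (r / 16))ᶜ
      · rw [Set.indicator_of_mem hz, Set.indicator_of_mem hz, mul_one_div]
      · rw [Set.indicator_of_notMem hz, Set.indicator_of_notMem hz, zero_div]
  refine mul_le_mul_of_nonneg_left ?_ (fracConst_pos hs0 hs1).le
  linarith

/-- Points off `B_{3r/4}` lie at distance at least `r/8` from the support of `Φ`, so the fractional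
Laplacian is minus an integral of `Φ` against a bounded kernel. Inside `B_r` this kernel is at least
`(2r)^{-n-2s}`. The last bound is the decay matching the weight in `MemL`. -/
theorem exists_fracLaplacian_bounds (hs0 : 0 < s) (hs1 : s < 1) (hr : 0 < r)
    (hΦ : Continuous Φ) (hΦ0 : ∀ x, 0 ≤ Φ x)
    (hsupp : ∀ x, 5 * r / 8 < dist x x₀ → Φ x = 0) :
    (∀ x, x ∉ Metric.ball x₀ (3 * r / 4) → fracLaplacian s Φ x ≤ 0) ∧
    (∀ x, x ∉ Metric.ball x₀ (3 * r / 4) → x ∈ Metric.ball x₀ r → fracLaplacian s Φ x ≤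
      -(fracConst n s * ((∫ y, Φ y) / (2 * r) ^ ((n : ℝ) + 2 * s)))) ∧
    ∃ K : ℝ, ∀ x, x ∉ Metric.ball x₀ (3 * r / 4) →
      |fracLaplacian s Φ x * (1 + ‖x‖ ^ ((n : ℝ) + 2 * s))| ≤ K := by
  set p := (n : ℝ) + 2 * s with hp
  have hp0 : 0 ≤ p := by positivity
  have hC := fracConst_pos (n := n) hs0 hs1
  have hΦc : HasCompactSupport Φ := HasCompactSupport.intro (isCompact_closedBall x₀ (5 * r / 8))
    fun x hx => hsupp x (not_le.1 (by simpa using hx))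
  have hΦi : Integrable Φ := hΦ.integrable_of_hasCompactSupport hΦc
  have hfar : ∀ x y, x ∉ Metric.ball x₀ (3 * r / 4) → ‖x - y‖ < r / 8 → Φ y = 0 := by
    intro x y hx hxy
    refine hsupp y ?_
    have hx' : 3 * r / 4 ≤ dist x x₀ := by simpa using hx
    rw [← dist_eq_norm] at hxy
    linarith [dist_triangle x y x₀]
  have heq : ∀ x, x ∉ Metric.ball x₀ (3 * r / 4) →
      fracLaplacian s Φ x = -(fracConst n s * ∫ y, Φ y / ‖x - y‖ ^ p) := fun x hx =>
    fracLaplacian_eq_of_forall_ball (by positivity : 0 < r / 8) fun y hy => hfar x y hx hy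
  have hquot : ∀ x, x ∉ Metric.ball x₀ (3 * r / 4) → Integrable fun y => Φ y / ‖x - y‖ ^ p := by
    intro x hx
    refine (hΦi.mul_const (1 / (r / 8) ^ p)).mono' ?_ (Eventually.of_forall fun y => ?_)
    · exact (hΦ.measurable.div (by fun_prop)).aestronglyMeasurable
    · rw [Real.norm_of_nonneg (div_nonneg (hΦ0 y) (by positivity)), mul_one_div]
      rcases lt_or_ge ‖x - y‖ (r / 8) with h | h
      · simp [hfar x y hx h]
      · have := hΦ0 y
        gcongr
  have hL0 : ∀ x, 0 ≤ ∫ y, Φ y / ‖x - y‖ ^ p := fun x =>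
    integral_nonneg fun y => div_nonneg (hΦ0 y) (by positivity)
  refine ⟨fun x hx => ?_, fun x hx hxr => ?_, ?_⟩
  · rw [heq x hx]
    exact neg_nonpos.2 (mul_nonneg hC.le (hL0 x))
  · rw [heq x hx, neg_le_neg_iff, ← integral_div]
    refine mul_le_mul_of_nonneg_left ?_ hC.le
    refine integral_mono (hΦi.div_const _) (hquot x hx) fun y => ?_
    change Φ y / (2 * r) ^ p ≤ Φ y / ‖x - y‖ ^ p
    rcases lt_or_ge (5 * r / 8) (dist y x₀) with h | h
    · simp [hsupp y h]
    rcases lt_or_ge ‖x - y‖ (r / 8) with h' | h'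
    · simp [hfar x y hx h']
    have h1 : ‖x - y‖ ≤ 2 * r := by
      rw [← dist_eq_norm]
      have : dist x x₀ < r := hxr
      linarith [dist_triangle_right x y x₀]
    have := hΦ0 y
    have : 0 < ‖x - y‖ := by linarith
    gcongr
  · set R := ‖x₀‖ + r with hR
    -- With `‖y‖ ≤ R` and `‖x - y‖ ≥ r/8`, one has `‖x‖ / ‖x - y‖ ≤ 1 + R / (r/8)`.
    set K₀ := 1 / (r / 8) ^ p + (1 + R / (r / 8)) ^ p with hK₀
    refine ⟨fracConst n s * ((∫ y, Φ y) * K₀), fun x hx => ?_⟩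
    rw [heq x hx, neg_mul, abs_neg, abs_of_nonneg
      (mul_nonneg (mul_nonneg hC.le (hL0 x)) (by positivity)), mul_assoc]
    refine mul_le_mul_of_nonneg_left ?_ hC.le
    rw [← integral_mul_const, ← integral_mul_const]
    refine integral_mono ((hquot x hx).mul_const _) (hΦi.mul_const _) fun y => ?_
    change Φ y / ‖x - y‖ ^ p * (1 + ‖x‖ ^ p) ≤ Φ y * K₀
    rcases lt_or_ge (5 * r / 8) (dist y x₀) with h | h
    · simp [hsupp y h]
    rcases lt_or_ge ‖x - y‖ (r / 8) with h' | h'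
    · simp [hfar x y hx h']
    have hxy : 0 < ‖x - y‖ := by linarith
    have hpos : 0 < ‖x - y‖ ^ p := Real.rpow_pos_of_pos hxy p
    rw [div_mul_eq_mul_div, mul_div_assoc]
    refine mul_le_mul_of_nonneg_left ?_ (hΦ0 y)
    rw [add_div, hK₀]
    refine add_le_add (by gcongr) ?_
    rw [← Real.div_rpow (norm_nonneg _) (norm_nonneg _)]
    refine Real.rpow_le_rpow (by positivity) ?_ hp0
    rw [div_le_iff₀ hxy, add_mul, one_mul]
    have hyR : ‖y‖ ≤ R := by
      have h3 : ‖y - x₀‖ ≤ 5 * r / 8 := by rwa [← dist_eq_norm]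
      have h4 := norm_add_le (y - x₀) x₀
      rw [sub_add_cancel] at h4
      linarith
    have hxn : ‖x‖ ≤ ‖x - y‖ + ‖y‖ := by
      have := norm_add_le (x - y) y
      rwa [sub_add_cancel] at this
    have hR0 : 0 ≤ R := (norm_nonneg y).trans hyR
    have : R ≤ R / (r / 8) * ‖x - y‖ := by
      rw [div_mul_eq_mul_div, le_div_iff₀ (by positivity)]
      gcongr
    linarith

end

theorem stronglyMeasurable_fracLaplacian (hn : 2 ≤ n) (hs0 : 0 < s) (hs1 : s < 1)
    {φ : E n → ℝ} (hφ : ContDiff ℝ 2 φ) (hc : HasCompactSupport φ) :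
    StronglyMeasurable (fracLaplacian s φ) := by
  have : fracLaplacian s φ = fun x => fracConst n s *
      (2⁻¹ * ∫ z, secondDiff φ x z / ‖z‖ ^ ((n : ℝ) + 2 * s)) :=
    funext fun x => fracLaplacian_eq hn hs0 hs1 hφ hc x
  rw [this]
  have hm : Measurable fun q : E n × E n => secondDiff φ q.1 q.2 / ‖q.2‖ ^ ((n : ℝ) + 2 * s) :=
    (continuous_uncurry_secondDiff hφ.continuous).measurable.div
      ((measurable_norm_rpow _).comp measurable_snd)
  exact (hm.stronglyMeasurable.integral_prod_right'.const_mul _).const_mul _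

/-- The mass of the annulus `B₁ \ B_{3/4}` weighted by the least value `2^{-n-2s}` of the kernel. -/
def annulusConst (n : ℕ) (s : ℝ) : ℝ :=
  (1 - (3 / 4 : ℝ) ^ n) * volume.real (Metric.ball (0 : E n) 1) / 2 ^ ((n : ℝ) + 2 * s)

theorem annulusConst_pos (hn : 2 ≤ n) : 0 < annulusConst n s := by
  have h1 : (3 / 4 : ℝ) ^ n < 1 := pow_lt_one₀ (by norm_num) (by norm_num) (by omega)
  have h2 : 0 < volume.real (Metric.ball (0 : E n) 1) :=
    ENNReal.toReal_pos (Metric.measure_ball_pos _ _ one_pos).ne' measure_ball_lt_top.ne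
  unfold annulusConst
  have : 0 < 1 - (3 / 4 : ℝ) ^ n := by linarith
  positivity

theorem volume_real_annulus (x₀ : E n) {r : ℝ} (hr : 0 < r) :
    volume.real (Metric.ball x₀ r \ Metric.ball x₀ (3 * r / 4)) =
      r ^ n * ((1 - (3 / 4 : ℝ) ^ n) * volume.real (Metric.ball (0 : E n) 1)) := by
  have hball : ∀ t : ℝ, 0 < t → volume.real (Metric.ball x₀ t) =
      t ^ n * volume.real (Metric.ball (0 : E n) 1) := by
    intro t ht
    rw [measureReal_def, Measure.addHaar_ball_of_pos _ _ ht, ENNReal.toReal_mul,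
      ENNReal.toReal_ofReal (by positivity), measureReal_def]
    simp
  rw [measureReal_sdiff (Metric.ball_subset_ball (by linarith)) measurableSet_ball
    measure_ball_lt_top.ne, hball _ hr, hball _ (by positivity)]
  rw [show 3 * r / 4 = 3 / 4 * r by ring, mul_pow]
  ring

theorem MemL.locallyIntegrable {u : E n → ℝ} {a : ℝ} (ha : 0 ≤ a) (hu : MemL a u) :
    LocallyIntegrable u := by
  have hpos : ∀ y : E n, 0 < 1 + ‖y‖ ^ ((n : ℝ) + a) := fun y => by positivity
  have hcont : Continuous fun y : E n => 1 + ‖y‖ ^ ((n : ℝ) + a) :=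
    continuous_const.add (continuous_norm.rpow_const fun _ => Or.inr (by positivity))
  refine locallyIntegrable_iff.2 fun K hK => ?_
  have h1 : IntegrableOn (fun y : E n => u y / (1 + ‖y‖ ^ ((n : ℝ) + a))) K :=
    Integrable.integrableOn hu
  refine (h1.mul_continuousOn hcont.continuousOn hK).congr (Eventually.of_forall fun y => ?_)
  exact div_mul_cancel₀ _ (hpos y).ne'

section

variable {Φ : E n → ℝ} {x₀ : E n} {r : ℝ}

/-- The contribution of the values of `u` far from the support of the test function. -/
theorem setIntegral_mul_fracLaplacian_far_le (hn : 2 ≤ n) (hs0 : 0 < s) (hs1 : s < 1)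
    (hr : 0 < r) (hΦ : ContDiff ℝ (⊤ : ℕ∞) Φ) (hΦ0 : ∀ x, 0 ≤ Φ x)
    (hsupp : ∀ x, 5 * r / 8 < dist x x₀ → Φ x = 0) {u : E n → ℝ} (hu : MemL (2 * s) u)
    (hu0 : ∀ᵐ x, 0 ≤ u x) {m : ℝ} (hm : 0 < m)
    (hum : ∀ᵐ x, x ∈ Metric.ball x₀ r \ Metric.ball x₀ (r / 2) → m ≤ u x) :
    IntegrableOn (fun x => u x * fracLaplacian s Φ x) (Metric.ball x₀ (3 * r / 4))ᶜ ∧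
    ∫ x in (Metric.ball x₀ (3 * r / 4))ᶜ, u x * fracLaplacian s Φ x ≤
      -(fracConst n s * ((∫ y, Φ y) * (r ^ (-(2 * s)) * (m * annulusConst n s)))) := by
  have hΦc : HasCompactSupport Φ := HasCompactSupport.intro (isCompact_closedBall x₀ (5 * r / 8))
    fun x hx => hsupp x (not_le.1 (by simpa using hx))
  have hΦ2 : ContDiff ℝ 2 Φ := mod_cast contDiff_infty.1 hΦ 2
  obtain ⟨hneg, hann, K, hK⟩ := exists_fracLaplacian_bounds hs0 hs1 hr hΦ.continuous hΦ0 hsupp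
  have hmeas := stronglyMeasurable_fracLaplacian hn hs0 hs1 hΦ2 hΦc
  have hSm : MeasurableSet (Metric.ball x₀ (3 * r / 4))ᶜ := measurableSet_ball.compl
  set p := (n : ℝ) + 2 * s with hp
  have hwm : Measurable fun x : E n => 1 + ‖x‖ ^ p := by fun_prop
  have hpos : ∀ y : E n, 0 < 1 + ‖y‖ ^ p := fun y => by positivity
  have hint : IntegrableOn (fun x => u x * fracLaplacian s Φ x)
      (Metric.ball x₀ (3 * r / 4))ᶜ := by
    have h1 : IntegrableOn (fun y : E n => u y / (1 + ‖y‖ ^ p)) (Metric.ball x₀ (3 * r / 4))ᶜ :=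
      Integrable.integrableOn hu
    have h2 := Integrable.mul_bdd (c := K) h1
      (g := fun x => fracLaplacian s Φ x * (1 + ‖x‖ ^ p))
      (hmeas.aestronglyMeasurable.mul hwm.aestronglyMeasurable)
      ((ae_restrict_iff' hSm).2 (Eventually.of_forall fun x hx => hK x hx))
    refine h2.congr (Eventually.of_forall fun x => ?_)
    have := (hpos x).ne'
    simp only
    field_simp
  refine ⟨hint, ?_⟩
  set T := Metric.ball x₀ r \ Metric.ball x₀ (3 * r / 4) with hT
  have hTm : MeasurableSet T := measurableSet_ball.diff measurableSet_ball
  have hTS : T ⊆ (Metric.ball x₀ (3 * r / 4))ᶜ := fun x hx => hx.2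
  have hTfin : volume T ≠ ⊤ :=
    ((measure_mono Set.sdiff_subset).trans_lt measure_ball_lt_top).ne
  set q := fracConst n s * ((∫ y, Φ y) / (2 * r) ^ p) with hq
  have hq0 : 0 ≤ q := mul_nonneg (fracConst_pos hs0 hs1).le
    (div_nonneg (integral_nonneg hΦ0) (by positivity))
  calc ∫ x in (Metric.ball x₀ (3 * r / 4))ᶜ, u x * fracLaplacian s Φ x
      ≤ ∫ x in (Metric.ball x₀ (3 * r / 4))ᶜ, T.indicator (fun _ => -(m * q)) x := by
        refine setIntegral_mono_ae_restrict hint ?_ ?_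
        · exact ((integrable_indicator_iff hTm).2 (integrableOn_const hTfin)).integrableOn
        · refine (ae_restrict_iff' hSm).2 ?_
          filter_upwards [hu0, hum] with x h0 h1 hxS
          by_cases hxT : x ∈ T
          · rw [Set.indicator_of_mem hxT]
            have hmu : m ≤ u x := h1 ⟨hxT.1, fun h => hxT.2
              (Metric.ball_subset_ball (by linarith) h)⟩
            have := hann x hxT.2 hxT.1
            nlinarith
          · rw [Set.indicator_of_notMem hxT]
            exact mul_nonpos_of_nonneg_of_nonpos h0 (hneg x hxS)
    _ = -(m * q) * volume.real T := by
        rw [setIntegral_indicator hTm, Set.inter_eq_right.2 hTS, setIntegral_const, smul_eq_mul,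
          mul_comm]
    _ = _ := by
        rw [hT, volume_real_annulus x₀ hr, hq, annulusConst, Real.mul_rpow (by norm_num) hr.le,
          Real.rpow_neg hr.le, hp, Real.rpow_add hr, Real.rpow_natCast]
        have h2 : (2 : ℝ) ^ ((n : ℝ) + 2 * s) ≠ 0 := (Real.rpow_pos_of_pos (by norm_num) _).ne'
        have h3 : r ^ (2 * s) ≠ 0 := (Real.rpow_pos_of_pos hr _).ne'
        field_simp

end

/-! ### Truncation of the supersolution -/

/-- The commutator argument uses a globally Lipschitz drift. Cutting off is harmless because the
test functions live where `b'` agrees with `b`. -/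
theorem exists_contDiff_hasCompactSupport_eqOn {b : E n → E n} {x₀ : E n} {r : ℝ} (hr : 0 < r)
    (hb : ContDiffOn ℝ 1 b (Metric.ball x₀ r)) :
    ∃ b' : E n → E n, ContDiff ℝ 1 b' ∧ HasCompactSupport b' ∧
      ∀ x ∈ Metric.ball x₀ (3 * r / 4), b' x = b x := by
  let χ : ContDiffBump x₀ := ⟨3 * r / 4, 7 * r / 8, by positivity, by linarith⟩
  have hχ : ∀ x, x ∉ Metric.closedBall x₀ (7 * r / 8) → χ x = 0 := fun x hx =>
    χ.zero_of_le_dist (not_le.1 (by simpa using hx)).le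
  refine ⟨fun x => χ x • b x, ?_, ?_, fun x hx => ?_⟩
  · refine contDiff_iff_contDiffAt.2 fun x => ?_
    by_cases hx : x ∈ Metric.ball x₀ r
    · exact χ.contDiff.contDiffAt.smul (hb.contDiffAt (Metric.isOpen_ball.mem_nhds hx))
    · have hx' : x ∈ (Metric.closedBall x₀ (7 * r / 8))ᶜ := fun h => hx
        (Metric.closedBall_subset_ball (by linarith) h)
      refine (contDiffAt_const (c := (0 : E n))).congr_of_eventuallyEq ?_
      filter_upwards [Metric.isClosed_closedBall.isOpen_compl.mem_nhds hx'] with y hy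
      rw [hχ y hy, zero_smul]
  · exact HasCompactSupport.intro (isCompact_closedBall x₀ (7 * r / 8)) fun x hx => by
      rw [hχ x hx, zero_smul]
  · have : χ x = 1 := χ.one_of_mem_closedBall (Metric.ball_subset_closedBall hx)
    simp [this]

theorem norm_fderiv_le_of_c1Norm_le {b : E n → E n} {Ω : Set (E n)} {M : ℝ} (hM : 0 ≤ M)
    (h : c1Norm b Ω ≤ ENNReal.ofReal M) {x : E n} (hx : x ∈ Ω) : ‖fderiv ℝ b x‖ ≤ M := by
  have h1 : ‖fderiv ℝ b x‖ₑ ≤ ENNReal.ofReal M :=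
    (le_iSup₂ (f := fun x (_ : x ∈ Ω) => ‖fderiv ℝ b x‖ₑ) x hx).trans (le_add_self.trans h)
  rwa [← ofReal_norm, ENNReal.ofReal_le_ofReal_iff hM] at h1

/-- Truncating a supersolution at a low level `k` inside the ball leaves a supersolution. -/
theorem truncation_test_nonneg (hn : 2 ≤ n) (hs0 : 0 < s) (hs1 : s < 1) {x₀ : E n} {r : ℝ}
    (hr : 0 < r) {b b' : E n → E n} {c u : E n → ℝ}
    (hb' : ContDiff ℝ 1 b') (hbb' : ∀ x ∈ Metric.ball x₀ (3 * r / 4), b' x = b x) {N : ℝ}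
    (hc : ∀ᵐ x, x ∈ Metric.ball x₀ r → c x ≤ N) (hu : MemL (2 * s) u)
    (hcu : LocallyIntegrableOn (fun x => c x * u x) (Metric.ball x₀ r))
    (hu0 : ∀ᵐ x, 0 ≤ u x) (hsup : IsSupersolution s b c u (openBall x₀ r)) {m : ℝ} (hm : 0 < m)
    (hum : ∀ᵐ x, x ∈ Metric.ball x₀ r \ Metric.ball x₀ (r / 2) → m ≤ u x) {k : ℝ} (hk : 0 ≤ k)
    (hkm : k * (fracConst n s * (r ^ (-(2 * s)) * kernelTail n s) + N) ≤
      fracConst n s * (r ^ (-(2 * s)) * (m * annulusConst n s)))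
    {Φ : E n → ℝ} (hΦ : ContDiff ℝ (⊤ : ℕ∞) Φ) (hΦ0 : ∀ x, 0 ≤ Φ x)
    (hts : tsupport Φ ⊆ Metric.closedBall x₀ (5 * r / 8)) :
    0 ≤ (∫ x, (Metric.ball x₀ (3 * r / 4)).indicator (fun x => u x - k) x * fracLaplacian s Φ x)
      - (∫ x, (Metric.ball x₀ (3 * r / 4)).indicator (fun x => u x - k) x *
          divergence (fun y => Φ y • b' y) x)
      + N * ∫ x, (Metric.ball x₀ (3 * r / 4)).indicator (fun x => u x - k) x * Φ x := by
  set S := Metric.ball x₀ (3 * r / 4) with hS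
  have hSm : MeasurableSet S := measurableSet_ball
  set v : E n → ℝ := S.indicator fun x => u x - k with hv
  have hsupp : ∀ x, 5 * r / 8 < dist x x₀ → Φ x = 0 := fun x hx =>
    image_eq_zero_of_notMem_tsupport fun h => absurd (hts h) (by simpa using hx)
  have hΦc : HasCompactSupport Φ :=
    (isCompact_closedBall x₀ (5 * r / 8)).of_isClosed_subset (isClosed_tsupport Φ) hts
  have hΦi : Integrable Φ := hΦ.continuous.integrable_of_hasCompactSupport hΦc
  have hΦ1 : ContDiff ℝ 1 Φ := hΦ.of_le (by exact_mod_cast le_top)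
  have hΦ2 : ContDiff ℝ 2 Φ := mod_cast contDiff_infty.1 hΦ 2
  have hloc : LocallyIntegrable u := hu.locallyIntegrable (by positivity)
  have huS : IntegrableOn u S := (hloc.integrableOn_isCompact
    (isCompact_closedBall x₀ (3 * r / 4))).mono_set Metric.ball_subset_closedBall
  have hkS : IntegrableOn (fun _ => k) S := integrableOn_const measure_ball_lt_top.ne
  have hvi : Integrable v := (integrable_indicator_iff hSm).2 (huS.sub hkS)
  have hw : Integrable (S.indicator fun _ => (1 : ℝ)) :=
    (integrable_indicator_iff hSm).2 (integrableOn_const measure_ball_lt_top.ne)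
  -- the nonlocal term
  have hLv := (integral_mul_fracLaplacian hn hs0 hs1 hΦ2 hΦc hvi).1
  have hL1 := (integral_mul_fracLaplacian hn hs0 hs1 hΦ2 hΦc hw).1
  obtain ⟨hfar, hfarle⟩ := setIntegral_mul_fracLaplacian_far_le hn hs0 hs1 hr hΦ hΦ0 hsupp hu hu0
    hm hum
  have hnear := setIntegral_fracLaplacian_le hn hs0 hs1 hr hΦ hΦ0 hsupp
  have hLS : IntegrableOn (fracLaplacian s Φ) S := by
    rw [← integrable_indicator_iff hSm]
    refine hL1.congr (Eventually.of_forall fun x => ?_)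
    by_cases hx : x ∈ S <;> simp [hx]
  -- This is the decomposition `u = v + k 1_S + u 1_{Sᶜ}`.
  have hsplit : ∫ x, u x * fracLaplacian s Φ x = (∫ x, v x * fracLaplacian s Φ x) +
      k * (∫ x in S, fracLaplacian s Φ x) + ∫ x in Sᶜ, u x * fracLaplacian s Φ x := by
    have hEq : Set.EqOn (fun x => u x * fracLaplacian s Φ x)
        (fun x => v x * fracLaplacian s Φ x + k * fracLaplacian s Φ x) S := by
      intro x hx
      simp only [hv, Set.indicator_of_mem hx]
      ring
    have hi : IntegrableOn (fun x => v x * fracLaplacian s Φ x + k * fracLaplacian s Φ x) S :=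
      hLv.integrableOn.add (hLS.const_mul k)
    have huSi : IntegrableOn (fun x => u x * fracLaplacian s Φ x) S :=
      hi.congr_fun hEq.symm hSm
    have hall : Integrable fun x => u x * fracLaplacian s Φ x := by
      rw [← integrableOn_univ, ← Set.union_compl_self S]
      exact huSi.union hfar
    rw [← integral_add_compl hSm hall, setIntegral_congr_fun hSm hEq,
      integral_add hLv.integrableOn (hLS.const_mul k), integral_const_mul]
    congr 2
    refine setIntegral_eq_integral_of_forall_compl_eq_zero fun x hx => ?_
    simp [hv, Set.indicator_of_notMem hx]
  -- the drift term
  have hΦb : (fun y => Φ y • b y) = fun y => Φ y • b' y := by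
    ext1 y
    rcases lt_or_ge (5 * r / 8) (dist y x₀) with h | h
    · simp [hsupp y h]
    · rw [hbb' y (by rw [hS, Metric.mem_ball]; linarith)]
  have hF : ContDiff ℝ 1 fun y => Φ y • b' y := hΦ1.smul hb'
  have hFc : HasCompactSupport fun y => Φ y • b' y := hΦc.smul_right
  have hFts : tsupport (fun y => Φ y • b' y) ⊆ Metric.closedBall x₀ (5 * r / 8) :=
    (tsupport_smul_subset_left Φ b').trans hts
  have hdz : ∀ x, x ∉ S → divergence (fun y => Φ y • b' y) x = 0 := fun x hx =>
    divergence_eq_zero_of_notMem_tsupport fun h => hx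
      (Metric.closedBall_subset_ball (by linarith) (hFts h))
  have hdcont := continuous_divergence hF
  have hdcs := hasCompactSupport_divergence hFc
  obtain ⟨D, hD⟩ := hdcont.bounded_above_of_compact_support hdcs
  have hdrift : ∫ x in Metric.ball x₀ r, u x * divergence (fun y => Φ y • b y) x =
      ∫ x, v x * divergence (fun y => Φ y • b' y) x := by
    rw [hΦb, setIntegral_eq_integral_of_forall_compl_eq_zero fun x hx => by
      rw [hdz x fun h => hx (Metric.ball_subset_ball (by linarith) h), mul_zero]]
    -- On `S` one has `u = v + k`, and off `S` the divergence vanishes. The constant `k` then drops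
    -- out, since a compactly supported divergence integrates to zero.
    have e : ∀ x, u x * divergence (fun y => Φ y • b' y) x =
        v x * divergence (fun y => Φ y • b' y) x + k * divergence (fun y => Φ y • b' y) x := by
      intro x
      by_cases hx : x ∈ S
      · simp only [hv, Set.indicator_of_mem hx]
        ring
      · simp [hdz x hx]
    simp_rw [e]
    rw [integral_add (hvi.mul_bdd (c := D) hdcont.aestronglyMeasurable (Eventually.of_forall hD))
      ((hdcont.integrable_of_hasCompactSupport hdcs).const_mul k), integral_const_mul,
      integral_divergence_eq_zero hF hFc, mul_zero, add_zero]
  -- the zeroth order term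
  obtain ⟨G, hG⟩ := hΦ.continuous.bounded_above_of_compact_support hΦc
  have hvΦ : Integrable fun x => v x * Φ x :=
    hvi.mul_bdd (c := G) hΦ.continuous.aestronglyMeasurable (Eventually.of_forall hG)
  have hcuΦ : Integrable fun x => c x * u x * Φ x := by
    have h1 : IntegrableOn (fun x => c x * u x) (Metric.closedBall x₀ (5 * r / 8)) :=
      hcu.integrableOn_compact_subset (Metric.closedBall_subset_ball (by linarith))
        (isCompact_closedBall _ _)
    refine (integrableOn_iff_integrable_of_support_subset fun x hx => ?_).1
      (h1.mul_continuousOn hΦ.continuous.continuousOn (isCompact_closedBall _ _))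
    refine hts (subset_tsupport _ fun h0 => hx ?_)
    simp [h0]
  have hzero : ∫ x in Metric.ball x₀ r, c x * u x * Φ x ≤
      N * (∫ x, v x * Φ x) + N * (k * ∫ x, Φ x) := by
    rw [setIntegral_eq_integral_of_forall_compl_eq_zero fun x hx => by
        rw [hsupp x (by
          have : r ≤ dist x x₀ := by simpa using hx
          linarith), mul_zero],
      ← integral_const_mul, ← integral_const_mul, ← integral_const_mul,
      ← integral_add (hvΦ.const_mul N) ((hΦi.const_mul k).const_mul N)]
    refine integral_mono_ae hcuΦ ((hvΦ.const_mul N).add ((hΦi.const_mul k).const_mul N)) ?_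
    filter_upwards [hc, hu0] with x hcx hux
    by_cases hx : x ∈ S
    · have h1 : c x ≤ N := hcx (Metric.ball_subset_ball (by linarith) hx)
      -- Only an upper bound on `c` is available; `u ≥ 0` makes it sufficient.
      have h2 : c x * u x * Φ x ≤ N * u x * Φ x := by
        have := hΦ0 x
        gcongr
      simp only [hv, Set.indicator_of_mem hx]
      linarith
    · have hx' : 3 * r / 4 ≤ dist x x₀ := by simpa [hS] using hx
      simp [hsupp x (by linarith)]
  have key := hsup ⟨Φ, hΦ, hΦc, hts.trans (Metric.closedBall_subset_ball (by linarith))⟩ hΦ0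
  change 0 ≤ (∫ x, u x * fracLaplacian s Φ x)
    - (∫ x in Metric.ball x₀ r, u x * divergence (fun y => Φ y • b y) x)
    + ∫ x in Metric.ball x₀ r, c x * u x * Φ x at key
  rw [hsplit, hdrift] at key
  have hI : 0 ≤ ∫ x, Φ x := integral_nonneg hΦ0
  have e1 := mul_le_mul_of_nonneg_left hnear hk
  have e2 := mul_le_mul_of_nonneg_left hkm hI
  linarith

end FracMaxPrinciple

end

/-! ### Choice of constants and conclusion -/

open FracMaxPrinciple in
theorem theorem1p6 (n : ℕ) (hn : 2 ≤ n) (s : ℝ) (hs0 : 0 < s) (hs1 : s < 1)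
    (M : ℝ) (hM : 0 < M) :
    ∃ α : ℝ, 0 < α ∧
      ∀ (x₀ : FracMaxPrinciple.E n) (r : ℝ), 0 < r → r ≤ 1 →
      ∀ (b : FracMaxPrinciple.E n → FracMaxPrinciple.E n) (c u : FracMaxPrinciple.E n → ℝ),
        ContDiffOn ℝ 1 b (Metric.ball x₀ r) →
        FracMaxPrinciple.c1Norm b (Metric.ball x₀ r) ≤ ENNReal.ofReal M →
        (∀ᵐ x, x ∈ Metric.ball x₀ r → c x ≤ M) →
        FracMaxPrinciple.MemL (2 * s) u →
        -- `c u` is locally integrable, so that it is a distribution on the ball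
        LocallyIntegrableOn (fun x => c x * u x) (Metric.ball x₀ r) →
        (∀ᵐ x, 0 ≤ u x) →
        FracMaxPrinciple.IsSupersolution s b c u (FracMaxPrinciple.openBall x₀ r) →
        ∀ m : ℝ, 0 < m →
        (∀ᵐ x, x ∈ Metric.ball x₀ r \ Metric.ball x₀ (r / 2) → m ≤ u x) →
        ∀ᵐ x, x ∈ Metric.ball x₀ r → α * m ≤ u x := by
  -- `M` dominates `c`, `n M / 2` absorbs half the divergence of the drift, and `1` is the surplus
  -- that gives the energy estimate.
  set N : ℝ := M + n * M / 2 + 1 with hN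
  have hN0 : 0 < N := by positivity
  have hC : 0 < fracConst n s := fracConst_pos hs0 hs1
  have hκ : 0 ≤ kernelTail n s := kernelTail_nonneg
  have ha : 0 < annulusConst n s := annulusConst_pos hn
  set Q : ℝ := fracConst n s * kernelTail n s + N with hQ
  have hQ0 : 0 < Q := by positivity
  -- The bound by `1` gives `k ≤ m`, hence `v ≥ 0` in the shell; the quotient is the balance between
  -- exterior gain and truncation cost.
  refine ⟨min 1 (fracConst n s * annulusConst n s / Q), by positivity, ?_⟩
  set α : ℝ := min 1 (fracConst n s * annulusConst n s / Q) with hα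
  have hα0 : 0 < α := by positivity
  have hα1 : α ≤ 1 := min_le_left _ _
  have hαQ : α * Q ≤ fracConst n s * annulusConst n s :=
    (le_div_iff₀ hQ0).1 (min_le_right _ _)
  intro x₀ r hr hr1 b c u hb hbM hc hu hcu hu0 hsup m hm hum
  obtain ⟨b', hb', hb'c, hbb'⟩ := exists_contDiff_hasCompactSupport_eqOn hr hb
  set k := α * m with hk
  have hk0 : 0 ≤ k := by positivity
  have hkle : k ≤ m := mul_le_of_le_one_left hm.le hα1
  set S := Metric.ball x₀ (3 * r / 4) with hS
  set v : E n → ℝ := S.indicator fun x => u x - k with hv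
  -- Since `r ≤ 1`, the unscaled cost `N` is at most `r^{-2s} N`, so all terms share the same power
  -- of `r` and `α` does not depend on `r`.
  have hr2 : 1 ≤ r ^ (-(2 * s)) :=
    Real.one_le_rpow_of_pos_of_le_one_of_nonpos hr hr1 (by linarith)
  have hkm : k * (fracConst n s * (r ^ (-(2 * s)) * kernelTail n s) + N) ≤
      fracConst n s * (r ^ (-(2 * s)) * (m * annulusConst n s)) := by
    have h1 : fracConst n s * (r ^ (-(2 * s)) * kernelTail n s) + N ≤ r ^ (-(2 * s)) * Q := by
      rw [hQ]
      nlinarith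
    calc _ ≤ k * (r ^ (-(2 * s)) * Q) := mul_le_mul_of_nonneg_left h1 hk0
      _ = r ^ (-(2 * s)) * m * (α * Q) := by rw [hk]; ring
      _ ≤ r ^ (-(2 * s)) * m * (fracConst n s * annulusConst n s) := by gcongr
      _ = _ := by ring
  have hloc : LocallyIntegrable u := hu.locallyIntegrable (by positivity)
  have huS : IntegrableOn u S := (hloc.integrableOn_isCompact
    (isCompact_closedBall x₀ (3 * r / 4))).mono_set Metric.ball_subset_closedBall
  have hvi : Integrable v := (integrable_indicator_iff measurableSet_ball).2
    (huS.sub (integrableOn_const measure_ball_lt_top.ne))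
  have hvk : ∀ᵐ x, -k ≤ v x := by
    filter_upwards [hu0] with x hx
    by_cases hxS : x ∈ S
    · simp only [hv, Set.indicator_of_mem hxS]
      linarith
    · simp [hv, Set.indicator_of_notMem hxS, hk0]
  have hv0 : ∀ᵐ x, x ∉ Metric.ball x₀ (r / 2) → 0 ≤ v x := by
    filter_upwards [hum] with x hx hxb
    by_cases hxS : x ∈ S
    · have := hx ⟨Metric.ball_subset_ball (by linarith) hxS, hxb⟩
      simp only [hv, Set.indicator_of_mem hxS]
      linarith
    · simp [hv, Set.indicator_of_notMem hxS]
  have hdiv : ∀ x ∈ Metric.ball x₀ (5 * r / 8), divergence b' x ≤ 2 * (N - 1) := by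
    intro x hx
    have hxS : x ∈ S := Metric.ball_subset_ball (by linarith) hx
    have hev : b' =ᶠ[𝓝 x] b := by
      filter_upwards [Metric.isOpen_ball.mem_nhds hxS] with y hy
      exact hbb' y hy
    have h1 : ‖fderiv ℝ b' x‖ ≤ M := by
      rw [hev.fderiv_eq]
      exact norm_fderiv_le_of_c1Norm_le hM.le hbM (Metric.ball_subset_ball (by linarith) hxS)
    have h2 := (le_abs_self _).trans
      (abs_divergence_le (hb'.differentiable one_ne_zero x) h1)
    rw [hN]
    linarith
  have hcN : ∀ᵐ x, x ∈ Metric.ball x₀ r → c x ≤ N := by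
    filter_upwards [hc] with x hx hxb
    have : (0 : ℝ) ≤ n * M / 2 := by positivity
    linarith [hx hxb]
  -- The radii are nested: the negative part of `v` lives in `B_{r/2}`, tests are supported up to
  -- `5r/8`, and the truncation is at `3r/4`.
  have hnonneg : ∀ᵐ x, 0 ≤ v x :=
    ae_nonneg_of_forall_test hn hs0 hs1 hvi hk0 hvk (by linarith : r / 2 < 5 * r / 8) hv0 hb' hb'c
      hdiv fun Φ hΦ hΦ0 hts => truncation_test_nonneg hn hs0 hs1 hr hb' hbb' hcN hu hcu hu0 hsup
        hm hum hk0 hkm hΦ hΦ0 hts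
  filter_upwards [hnonneg, hum] with x hx1 hx2 hxr
  by_cases hxS : x ∈ S
  · simp only [hv, Set.indicator_of_mem hxS] at hx1
    linarith
  · exact hkle.trans (hx2 ⟨hxr, fun h => hxS (Metric.ball_subset_ball (by linarith) h)⟩)
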